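/- Let $N\ge 3$ be an integer, $\alpha\in(0,N)$ and $p,q>0$. Let $$I_\alpha(x)=\frac{\Gamma(\frac{N-\alpha}{2})}{\pi^{N/2}2^{\alpha}\Gamma(\frac{\alpha}{2})}\,|x|^{\alpha-N}$$ be the Riesz potential on $\mathbb R^N$. A function $u:\mathbb R^N\to\mathbb R$ is called a weak solution of $$-\Delta u+u=f_u:=q\,(I_\alpha*|u|^p)|u|^{q-2}u+p\,(I_\alpha*|u|^q)|u|^{p-2}u\quad\text{in }\mathbb R^N \tag{1}$$ if $u\in H^1(\mathbb R^N)$, the convolutions $I_\alpha*|u|^p$ and $I_\alpha*|u|^q$ converge almost everywhere, $f_u\in L^1_{\rm loc}(\mathbb R^N)$ (with $|u|^{q-2}u$ and $|u|^{p-2}u$ read as $0$ where $u=0$), and $$\int_{\mathbb R^N}\nabla u\cdot\nabla\varphi\,dx+\int_{\mathbb R^N}u\,\varphi\,dx=\int_{\mathbb R^N}f_u\,\varphi\,dx\qquad\text{for all }\varphi\in C_c^\infty(\mathbb R^N).$$ Let $u\in H^1(\mathbb R^N)\cap L^{\frac{N(p+q)}{N+\alpha}}(\mathbb R^N)$ be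 a weak solution of (1) whose weak gradient satisfies $\nabla u\in H^1_{\rm loc}(\mathbb R^N)$, that is, every weak partial derivative $\partial_i u$ belongs to $H^1_{\rm loc}(\mathbb R^N)$. Then $|\nabla u|^2$, $|u|^2$ and $(I_\alpha*|u|^p)|u|^q$ are integrable on $\mathbb R^N$ and $$\frac{N-2}{2}\int_{\mathbb R^N}|\nabla u|^2\,dx+\frac N2\int_{\mathbb R^N}|u|^2\,dx=(N+\alpha)\int_{\mathbb R^N}(I_\alpha*|u|^p)(x)\,|u(x)|^q\,dx.$$ -/

import Mathlib

open MeasureTheory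
open scoped ContDiff Convolution Gradient

namespace Choquard

/-- `G` is the weak gradient of `u` on `ℝ^N`: both are locally integrable and
`∫ u ∇φ = - ∫ φ G` for every real test function `φ ∈ C_c^∞(ℝ^N)`. -/
def IsWeakGradient {N : ℕ} (u : EuclideanSpace ℝ (Fin N) → ℝ)
    (G : EuclideanSpace ℝ (Fin N) → EuclideanSpace ℝ (Fin N)) : Prop :=
  LocallyIntegrable u ∧ LocallyIntegrable G ∧
    ∀ φ : EuclideanSpace ℝ (Fin N) → ℝ, ContDiff ℝ ∞ φ → HasCompactSupport φ →
      ∫ x, u x • ∇ φ x = - ∫ x, φ x • G x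

/-- The Sobolev space `H¹(ℝ^N)`: `u ∈ L²` with a weak gradient in `L²`. -/
def MemH1 {N : ℕ} (u : EuclideanSpace ℝ (Fin N) → ℝ) : Prop :=
  MemLp u 2 ∧ ∃ G, IsWeakGradient u G ∧ MemLp G 2

/-- The local Sobolev space `H¹_loc(ℝ^N)`: `u` has a weak gradient, and both are square integrable
on every compact set. -/
def MemH1Loc {N : ℕ} (u : EuclideanSpace ℝ (Fin N) → ℝ) : Prop :=
  (∀ K : Set (EuclideanSpace ℝ (Fin N)), IsCompact K → MemLp u 2 (volume.restrict K)) ∧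
    ∃ G, IsWeakGradient u G ∧
      ∀ K : Set (EuclideanSpace ℝ (Fin N)), IsCompact K → MemLp G 2 (volume.restrict K)

/-- The Riesz potential
`I_α(x) = Γ((N-α)/2) |x|^(α-N) / (π^(N/2) 2^α Γ(α/2))` on `ℝ^N`. -/
noncomputable def rieszPotential (N : ℕ) (α : ℝ) (x : EuclideanSpace ℝ (Fin N)) : ℝ :=
  Real.Gamma (((N : ℝ) - α) / 2) * ‖x‖ ^ (α - (N : ℝ)) /
    (Real.pi ^ ((N : ℝ) / 2) * (2 : ℝ) ^ α * Real.Gamma (α / 2))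

/-- The convolution `I_α * |u|^r`. -/
noncomputable def rieszConv {N : ℕ} (α r : ℝ) (u : EuclideanSpace ℝ (Fin N) → ℝ) :
    EuclideanSpace ℝ (Fin N) → ℝ :=
  rieszPotential N α ⋆ (fun y => |u y| ^ r)

/-- The convolution integral defining `I_α * |u|^r` converges at almost every point. -/
def RieszConvExists {N : ℕ} (α r : ℝ) (u : EuclideanSpace ℝ (Fin N) → ℝ) : Prop :=
  ∀ᵐ x, ConvolutionExistsAt (rieszPotential N α) (fun y => |u y| ^ r) x
    (ContinuousLinearMap.lsmul ℝ ℝ) volume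

/-- The right-hand side `q (I_α * |u|^p) |u|^(q-2) u + p (I_α * |u|^q) |u|^(p-2) u` of the Choquard
equation. Each factor `|u|^(r-2) u` is written as a product, so it vanishes where `u = 0`. -/
noncomputable def choquardRHS {N : ℕ} (α p q : ℝ) (u : EuclideanSpace ℝ (Fin N) → ℝ)
    (x : EuclideanSpace ℝ (Fin N)) : ℝ :=
  q * rieszConv α p u x * (|u x| ^ (q - 2) * u x) +
    p * rieszConv α q u x * (|u x| ^ (p - 2) * u x)

/-- `u ∈ H¹(ℝ^N)` is a weak solution of
`-Δu + u = q (I_α * |u|^p) |u|^(q-2) u + p (I_α * |u|^q) |u|^(p-2) u`: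
the right-hand side is meaningful (both convolutions converge almost everywhere) and is locally
integrable, and the equation holds against every test function in `C_c^∞(ℝ^N)`. -/
structure IsWeakSolution {N : ℕ} (α p q : ℝ) (u : EuclideanSpace ℝ (Fin N) → ℝ) : Prop where
  memH1 : MemH1 u
  conv_p : RieszConvExists α p u
  conv_q : RieszConvExists α q u
  locallyIntegrable_rhs : LocallyIntegrable (choquardRHS α p q u)
  weak_eq : ∀ G, IsWeakGradient u G →
    ∀ φ : EuclideanSpace ℝ (Fin N) → ℝ, ContDiff ℝ ∞ φ → HasCompactSupport φ →
      (∫ x, inner ℝ (G x) (∇ φ x)) + ∫ x, u x * φ x = ∫ x, choquardRHS α p q u x * φ x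

end Choquard

/-!
The identity comes from testing the equation against `V · ∇u`, where `V` is a truncation of the
dilation field `x ↦ x`.

Since the weak second derivatives of `u` are locally square integrable, the equation holds almost
everywhere (`IsWeakSolution.ae_eq`), with a source `f` that is locally in `L²`.  As `f u` is
nonnegative, testing with `χ u` for growing cutoffs `χ` bounds `∫ f u` by the `H¹` norm of `u`
(`integrable_sub_laplacian_mul_self`).  This makes the nonlinear energy
`∬ I(x - y) |u(y)|^p |u(x)|^q` finite.

For a compactly supported field `V`, the product rule turns `∫ (u - Δu) V · ∇u` into integrals of
`|u|²` and `∂ᵢu ∂ⱼu` against first derivatives of `V` (`integral_sub_laplacian_mul_field`).  On the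
nonlinear side one needs `∇|u|^q = q |u|^(q-2) u ∇u` also for `q < 1`.  This holds because
`I_α * |u|^p` is bounded below on balls (`exists_le_rieszInt`), so the right-hand side inherits
local integrability from `f ∇u` (`locallyIntegrable_rpow_mul`, `HasWeakDeriv.abs_rpow`).  The
kernel is replaced by the smooth kernel with `|z|² + s` in place of `|z|²`, integrated by parts in
`x` and in `y`, and the two resulting gradients of the kernel are paired into
`∇I(x - y) · (V(x) - V(y))`.  As `V` is Lipschitz this is of order `I(x - y)`, so the limit `s → 0`
is harmless (`integral_rieszInt_mul_field`).

Finally `V` runs through the rescalings `m W(x / m)` of one field `W` that is the identity near the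
origin.  Their derivatives are uniformly bounded and converge to the identity, and dominated
convergence gives the coefficients `(N - 2) / 2`, `N / 2` and `2N + (α - N) = N + α`.
-/

namespace Choquard

open Filter Topology Metric

/-! ### Mollification in `L¹` -/

/-- A bump function at the origin of outer radius `1 / (n + 1)`. -/
noncomputable def mollifier {E : Type*} [NormedAddCommGroup E] (n : ℕ) : ContDiffBump (0 : E) where
  rIn := 1 / (2 * (n + 1))
  rOut := 1 / (n + 1)
  rIn_pos := by positivity
  rIn_lt_rOut := by
    apply one_div_lt_one_div_of_lt <;> [positivity; linarith [(n.cast_nonneg : (0 : ℝ) ≤ n)]]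

theorem mollifier_rOut_le {E : Type*} [NormedAddCommGroup E] (n : ℕ) :
    (mollifier (E := E) n).rOut ≤ 1 := by
  change (1 : ℝ) / (n + 1) ≤ 1
  rw [div_le_one (by positivity)]
  linarith [(n.cast_nonneg : (0 : ℝ) ≤ n)]

section WeakDerivatives

variable {E : Type*} [NormedAddCommGroup E] [InnerProductSpace ℝ E] [FiniteDimensional ℝ E]
  [MeasurableSpace E] [BorelSpace E]

/-- Almost everywhere convergence together with a bound of the `L¹` norms by that of the limit
gives convergence in `L¹`. -/
theorem tendsto_integral_abs_sub_of_integral_abs_le {X : Type*} [MeasurableSpace X] {μ : Measure X}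
    {F : ℕ → X → ℝ} {f : X → ℝ} (hF : ∀ n, Integrable (F n) μ) (hf : Integrable f μ)
    (hle : ∀ n, ∫ x, |F n x| ∂μ ≤ ∫ x, |f x| ∂μ)
    (hlim : ∀ᵐ x ∂μ, Tendsto (fun n => F n x) atTop (𝓝 (f x))) :
    Tendsto (fun n => ∫ x, |F n x - f x| ∂μ) atTop (𝓝 0) := by
  -- dominated convergence applies to `|F n| + |f| - |F n - f|`, which lies between `0` and `2 |f|`
  have key : Tendsto (fun n => ∫ x, (|F n x| + |f x| - |F n x - f x|) ∂μ) atTop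
      (𝓝 (∫ x, (|f x| + |f x| - |f x - f x|) ∂μ)) := by
    refine tendsto_integral_of_dominated_convergence (fun x => 2 * |f x|) (fun n => ?_) ?_
      (fun n => ?_) ?_
    · exact (((hF n).abs.add hf.abs).sub ((hF n).sub hf).abs).aestronglyMeasurable
    · exact hf.abs.const_mul 2
    · refine ae_of_all _ fun x => ?_
      have h1 := abs_sub_abs_le_abs_sub (F n x) (f x)
      have h2 := abs_sub (F n x) (f x)
      have h3 := abs_sub_abs_le_abs_sub (f x) (F n x)
      rw [abs_sub_comm (f x)] at h3
      rw [Real.norm_eq_abs, abs_le]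
      constructor <;> linarith
    · filter_upwards [hlim] with x hx
      exact ((hx.abs.add_const _).sub (hx.sub_const _).abs)
  have e1 : ∀ n, ∫ x, (|F n x| + |f x| - |F n x - f x|) ∂μ
      = ∫ x, |F n x| ∂μ + ∫ x, |f x| ∂μ - ∫ x, |F n x - f x| ∂μ := fun n => by
    rw [← integral_add (hF n).abs hf.abs]
    exact integral_sub ((hF n).abs.add hf.abs) ((hF n).sub hf).abs
  have e2 : ∫ x, (|f x| + |f x| - |f x - f x|) ∂μ = 2 * ∫ x, |f x| ∂μ := by
    rw [← integral_const_mul]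
    exact integral_congr_ae (ae_of_all _ fun x => by simp; ring)
  rw [e2] at key
  have lim : Tendsto (fun n => 2 * ∫ x, |f x| ∂μ - ∫ x, (|F n x| + |f x| - |F n x - f x|) ∂μ)
      atTop (𝓝 0) := by simpa using key.const_sub (2 * ∫ x, |f x| ∂μ)
  refine squeeze_zero (fun n => integral_nonneg fun x => abs_nonneg _) (fun n => ?_) lim
  rw [e1]; linarith [hle n]

/-- The mollification `ρ_n * f` of a function. -/
noncomputable def mollify (n : ℕ) (f : E → ℝ) : E → ℝ :=
  (mollifier (E := E) n).normed volume ⋆[ContinuousLinearMap.lsmul ℝ ℝ, volume] f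

theorem integrable_mollify (n : ℕ) {f : E → ℝ} (hf : Integrable f) : Integrable (mollify n f) :=
  (mollifier n).integrable_normed.integrable_convolution _ hf

theorem mollify_tendsto_ae {f : E → ℝ} (hf : LocallyIntegrable f) :
    ∀ᵐ x, Tendsto (fun n => mollify n f x) atTop (𝓝 (f x)) := by
  refine ContDiffBump.ae_convolution_tendsto_right_of_locallyIntegrable (K := 2) ?_ ?_ hf
  · exact tendsto_one_div_add_atTop_nhds_zero_nat
  · refine Eventually.of_forall fun n => le_of_eq ?_
    change (1 : ℝ) / (n + 1) = 2 * (1 / (2 * (n + 1)))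
    field_simp

theorem integral_abs_mollify_le (n : ℕ) {f : E → ℝ} (hf : Integrable f) :
    ∫ x, |mollify n f x| ≤ ∫ x, |f x| := by
  have h1 : ∀ x, |mollify n f x| ≤ mollify n (fun y => |f y|) x := fun x => by
    refine (abs_integral_le_integral_abs).trans (le_of_eq (integral_congr_ae (ae_of_all _ ?_)))
    intro t
    simp [abs_mul, abs_of_nonneg ((mollifier n).nonneg_normed t)]
  calc ∫ x, |mollify n f x| ≤ ∫ x, mollify n (fun y => |f y|) x :=
        integral_mono (integrable_mollify n hf).abs (integrable_mollify n hf.abs) h1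
    _ = ∫ x, |f x| := by
        unfold mollify
        rw [integral_convolution _ (mollifier n).integrable_normed hf.abs,
          (mollifier n).integral_normed]
        simp

theorem tendsto_integral_abs_mollify_sub {f : E → ℝ} (hf : Integrable f) :
    Tendsto (fun n => ∫ x, |mollify n f x - f x|) atTop (𝓝 0) :=
  tendsto_integral_abs_sub_of_integral_abs_le (fun n => integrable_mollify n hf) hf
    (fun n => integral_abs_mollify_le n hf) (mollify_tendsto_ae hf.locallyIntegrable)

theorem contDiff_mollify (n : ℕ) {f : E → ℝ} (hf : LocallyIntegrable f) :
    ContDiff ℝ ∞ (mollify n f) :=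
  (mollifier n).hasCompactSupport_normed.contDiff_convolution_left _
    (mollifier n).contDiff_normed hf

/-! ### Weak directional derivatives -/

theorem locallyIntegrable_abs {f : E → ℝ} (hf : LocallyIntegrable f) :
    LocallyIntegrable (fun x => |f x|) :=
  hf.mono hf.aestronglyMeasurable.norm (ae_of_all _ fun x => by simp)

/-- `g` is the weak derivative of `f` in the direction `v`. -/
def HasWeakDeriv (v : E) (f g : E → ℝ) : Prop :=
  LocallyIntegrable f ∧ LocallyIntegrable g ∧
    ∀ φ : E → ℝ, ContDiff ℝ ∞ φ → HasCompactSupport φ →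
      ∫ x, f x * fderiv ℝ φ x v = - ∫ x, φ x * g x

/-- Mollifying the restriction of `f` to `B` and differentiating at a point whose unit neighbourhood
lies in `B` is the same as mollifying the restriction of the weak derivative. -/
theorem HasWeakDeriv.fderiv_mollify_indicator {v : E} {f g : E → ℝ} (h : HasWeakDeriv v f g)
    {B : Set E} (hfB : Integrable (B.indicator f)) {x : E}
    (hx : closedBall x 1 ⊆ B) (n : ℕ) :
    fderiv ℝ (mollify n (B.indicator f)) x v = mollify n (B.indicator g) x := by
  set ρ : E → ℝ := (mollifier (E := E) n).normed volume with hρ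
  have hρs : ContDiff ℝ ∞ ρ := (mollifier n).contDiff_normed
  have hρc : HasCompactSupport ρ := (mollifier n).hasCompactSupport_normed
  have hsupp : ∀ t, t ∉ B → x - t ∉ tsupport ρ := fun t ht h0 => ht <| hx <| by
    rw [hρ, (mollifier n).tsupport_normed_eq, mem_closedBall, dist_zero_right] at h0
    rw [mem_closedBall, dist_comm, dist_eq_norm]
    exact h0.trans (mollifier_rOut_le n)
  have h1 : HasFDerivAt (mollify n (B.indicator f)) _ x :=
    hρc.hasFDerivAt_convolution_left (ContinuousLinearMap.lsmul ℝ ℝ) (hρs.of_le (by simp))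
      hfB.locallyIntegrable x
  have hd : ∀ t, HasFDerivAt (fun t => ρ (x - t)) (-(fderiv ℝ ρ (x - t))) t := fun t => by
    have := ((hρs.differentiable (by simp)).differentiableAt (x := x - t)).hasFDerivAt.comp t
      ((hasFDerivAt_id t).const_sub x)
    rw [ContinuousLinearMap.comp_neg, ContinuousLinearMap.comp_id] at this
    exact this
  have hw := h.2.2 (fun t => ρ (x - t)) (hρs.comp (contDiff_const.sub contDiff_id))
    (hρc.comp_homeomorph (Homeomorph.subLeft x))
  have hint : Integrable (fun t => ((ContinuousLinearMap.lsmul ℝ ℝ).precompL E)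
      (fderiv ℝ ρ (x - t)) (B.indicator f t)) := by
    have := (hρc.fderiv ℝ).convolutionExists_left ((ContinuousLinearMap.lsmul ℝ ℝ).precompL E)
      (hρs.continuous_fderiv (by simp)) hfB.locallyIntegrable x
    exact this.integrable_swap
  rw [h1.fderiv, convolution_eq_swap, ContinuousLinearMap.integral_apply hint, mollify,
    convolution_eq_swap]
  calc ∫ t, ((ContinuousLinearMap.lsmul ℝ ℝ).precompL E)
        (fderiv ℝ ρ (x - t)) (B.indicator f t) v
      = - ∫ t, f t * fderiv ℝ (fun t => ρ (x - t)) t v := by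
        rw [← integral_neg]
        refine integral_congr_ae (ae_of_all _ fun t => ?_)
        simp only [ContinuousLinearMap.precompL_apply, ContinuousLinearMap.lsmul_apply,
          (hd t).fderiv, neg_apply, smul_eq_mul]
        by_cases ht : t ∈ B
        · rw [Set.indicator_of_mem ht]; ring
        · have : fderiv ℝ ρ (x - t) = 0 :=
            image_eq_zero_of_notMem_tsupport fun h0 => hsupp t ht (tsupport_fderiv_subset ℝ h0)
          simp [this]
    _ = ∫ t, ρ (x - t) * g t := by rw [hw, neg_neg]
    _ = _ := by
        refine integral_congr_ae (ae_of_all _ fun t => ?_)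
        by_cases ht : t ∈ B
        · simp [ht, hρ]
        · simp [ht, image_eq_zero_of_notMem_tsupport (hsupp t ht)]

/-- Chain rule: composing with a `C¹` function with bounded derivative. -/
theorem HasWeakDeriv.comp_of_deriv_bounded {v : E} {f g : E → ℝ} (h : HasWeakDeriv v f g)
    {F : ℝ → ℝ} (hF : ContDiff ℝ 1 F) {C : ℝ} (hC : ∀ t, |deriv F t| ≤ C) :
    HasWeakDeriv v (fun x => F (f x)) (fun x => deriv F (f x) * g x) := by
  have hFc : Continuous F := hF.continuous
  have hF'c : Continuous (deriv F) := hF.continuous_deriv le_rfl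
  have hC0 : 0 ≤ C := (abs_nonneg _).trans (hC 0)
  have hLip : ∀ s t, |F s - F t| ≤ C * |s - t| := fun s t => by
    have := Convex.norm_image_sub_le_of_norm_deriv_le (f := F) (C := C) (s := Set.univ) (x := t)
      (y := s) (fun x _ => (hF.differentiable (by simp)).differentiableAt) (fun x _ => hC x)
      convex_univ trivial trivial
    simpa using this
  have hfm : AEStronglyMeasurable f := h.1.aestronglyMeasurable
  have hgm : AEStronglyMeasurable g := h.2.1.aestronglyMeasurable
  have hli : LocallyIntegrable (fun x => F (f x)) := by
    have : LocallyIntegrable (fun x => |F 0| + C * |f x|) :=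
      (continuous_const.locallyIntegrable).add ((locallyIntegrable_abs h.1).smul C)
    refine this.mono (hFc.comp_aestronglyMeasurable hfm) (ae_of_all _ fun x => ?_)
    rw [Real.norm_eq_abs, Real.norm_eq_abs, abs_of_nonneg (a := |F 0| + _) (by positivity)]
    have h1 := hLip (f x) 0
    have h2 := abs_sub_abs_le_abs_sub (F (f x)) (F 0)
    rw [sub_zero] at h1
    linarith
  have hli' : LocallyIntegrable (fun x => deriv F (f x) * g x) := by
    refine (h.2.1.smul C).mono ((hF'c.comp_aestronglyMeasurable hfm).mul hgm)
      (ae_of_all _ fun x => ?_)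
    simp only [norm_mul, Pi.smul_apply, smul_eq_mul, Real.norm_eq_abs, abs_of_nonneg hC0]
    gcongr
    exact hC _
  refine ⟨hli, hli', fun φ hφ hφc => ?_⟩
  obtain ⟨R, hR⟩ := hφc.isBounded.subset_closedBall (0 : E)
  set B : Set E := closedBall 0 (R + 1) with hBdef
  have hB : MeasurableSet B := measurableSet_closedBall
  have hBc : IsCompact B := isCompact_closedBall _ _
  have hball : ∀ x ∈ tsupport φ, closedBall x 1 ⊆ B := fun x hx =>
    closedBall_subset_closedBall' (by
      have := hR hx
      rw [mem_closedBall] at this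
      linarith)
  have hBφ : ∀ x ∈ tsupport φ, x ∈ B := fun x hx => hball x hx (mem_closedBall_self zero_le_one)
  have hfB : Integrable (B.indicator f) :=
    (h.1.integrableOn_isCompact hBc).integrable_indicator hB
  have hgB : Integrable (B.indicator g) :=
    (h.2.1.integrableOn_isCompact hBc).integrable_indicator hB
  set fn : ℕ → E → ℝ := fun n => mollify n (B.indicator f) with hfn
  set gn : ℕ → E → ℝ := fun n => mollify n (B.indicator g) with hgn
  have hfnd : ∀ n, ContDiff ℝ 1 (fn n) := fun n =>
    (contDiff_mollify n hfB.locallyIntegrable).of_le (by simp)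
  have hgnc : ∀ n, Continuous (gn n) := fun n =>
    (contDiff_mollify n hgB.locallyIntegrable).continuous
  have hφ1 : ContDiff ℝ 1 φ := hφ.of_le (by simp)
  have hdφ : Continuous (fun x => fderiv ℝ φ x v) :=
    (hφ.continuous_fderiv (by simp)).clm_apply continuous_const
  have hdφc : HasCompactSupport (fun x => fderiv ℝ φ x v) :=
    hφc.fderiv_apply ℝ v
  obtain ⟨M, hM⟩ := hφ.continuous.bounded_above_of_compact_support hφc
  obtain ⟨M', hM'⟩ := hdφ.bounded_above_of_compact_support hdφc
  have hM0 : 0 ≤ M := (norm_nonneg _).trans (hM 0)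
  have hM0' : 0 ≤ M' := (norm_nonneg _).trans (hM' 0)
  have hφ0 : ∀ x, x ∉ B → φ x = 0 := fun x hx =>
    image_eq_zero_of_notMem_tsupport fun h0 => hx (hBφ x h0)
  have hdφ0 : ∀ x, x ∉ B → fderiv ℝ φ x v = 0 := fun x hx => by
    rw [image_eq_zero_of_notMem_tsupport fun h0 => hx (hBφ x (tsupport_fderiv_subset ℝ h0))]
    rfl
  -- the identity for the mollified functions is a classical integration by parts
  have hn : ∀ n, ∫ x, F (fn n x) * fderiv ℝ φ x v = - ∫ x, φ x * (deriv F (fn n x) * gn n x) := by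
    intro n
    have hdn : ∀ x, HasFDerivAt (fun x => F (fn n x)) (deriv F (fn n x) • fderiv ℝ (fn n) x) x :=
      fun x => (hF.differentiable (by simp)).differentiableAt.hasDerivAt.comp_hasFDerivAt x
        ((hfnd n).differentiable (by simp)).differentiableAt.hasFDerivAt
    have hFn : ContDiff ℝ 1 (fun x => F (fn n x)) := hF.comp (hfnd n)
    have hdc : Continuous fun x => fderiv ℝ (fun x => F (fn n x)) x v :=
      (hFn.continuous_fderiv (by simp)).clm_apply continuous_const
    rw [integral_mul_fderiv_eq_neg_fderiv_mul_of_integrable]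
    · congr 1
      refine integral_congr_ae (ae_of_all _ fun x => ?_)
      by_cases hx : x ∈ tsupport φ
      · have e := h.fderiv_mollify_indicator hfB (hball x hx) n
        change fderiv ℝ (fun x => F (fn n x)) x v * φ x = φ x * (deriv F (fn n x) * gn n x)
        rw [(hdn x).fderiv, smul_apply, smul_eq_mul, e]
        ring
      · simp [image_eq_zero_of_notMem_tsupport hx]
    · exact (hdc.mul hφ.continuous).integrable_of_hasCompactSupport hφc.mul_left
    · exact (hFn.continuous.mul hdφ).integrable_of_hasCompactSupport hdφc.mul_left
    · exact (hFn.continuous.mul hφ.continuous).integrable_of_hasCompactSupport hφc.mul_left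
    · exact fun x _ => (hFn.differentiable (by simp)).differentiableAt
    · exact fun x _ => (hφ1.differentiable (by simp)).differentiableAt
  have hfi : Integrable (fun x => F (f x) * fderiv ℝ φ x v) :=
    hli.integrable_smul_right_of_hasCompactSupport hdφ hdφc
  have hgi : Integrable (fun x => φ x * (deriv F (f x) * g x)) :=
    hli'.integrable_smul_left_of_hasCompactSupport hφ.continuous hφc
  have hfni : ∀ n, Integrable (fun x => F (fn n x) * fderiv ℝ φ x v) := fun n =>
    ((hFc.comp (hfnd n).continuous).mul hdφ).integrable_of_hasCompactSupport hdφc.mul_left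
  have hgni : ∀ n, Integrable (fun x => φ x * (deriv F (fn n x) * gn n x)) := fun n =>
    (hφ.continuous.mul ((hF'c.comp (hfnd n).continuous).mul
      (hgnc n))).integrable_of_hasCompactSupport hφc.mul_right
  have hfs : ∀ n, Integrable (fun x => |fn n x - B.indicator f x|) := fun n =>
    ((integrable_mollify n hfB).sub hfB).abs
  have hgs : ∀ n, Integrable (fun x => |gn n x - B.indicator g x|) := fun n =>
    ((integrable_mollify n hgB).sub hgB).abs
  have lim1 : Tendsto (fun n => ∫ x, F (fn n x) * fderiv ℝ φ x v) atTop
      (𝓝 (∫ x, F (f x) * fderiv ℝ φ x v)) := by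
    rw [tendsto_iff_dist_tendsto_zero]
    have l0 : Tendsto (fun n => C * M' * ∫ x, |fn n x - B.indicator f x|) atTop (𝓝 0) := by
      simpa using (tendsto_integral_abs_mollify_sub hfB).const_mul (C * M')
    refine squeeze_zero (fun n => dist_nonneg) (fun n => ?_) l0
    rw [Real.dist_eq, ← integral_sub (hfni n) hfi, ← integral_const_mul]
    refine abs_integral_le_integral_abs.trans
      (integral_mono ((hfni n).sub hfi).abs ((hfs n).const_mul _) fun x => ?_)
    by_cases hx : x ∈ B
    · simp only [hx, Set.indicator_of_mem, ← sub_mul, abs_mul]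
      calc |F (fn n x) - F (f x)| * |fderiv ℝ φ x v| ≤ (C * |fn n x - f x|) * M' :=
            mul_le_mul (hLip _ _) (hM' x) (abs_nonneg _) (by positivity)
        _ = _ := by ring
    · simp only [hdφ0 x hx, mul_zero, sub_zero, abs_zero]
      positivity
  have lim2 : Tendsto (fun n => ∫ x, φ x * (deriv F (fn n x) * gn n x)) atTop
      (𝓝 (∫ x, φ x * (deriv F (f x) * g x))) := by
    have hmid : Tendsto (fun n => ∫ x, |φ x| *
        (|deriv F (fn n x) - deriv F (B.indicator f x)| * |B.indicator g x|)) atTop (𝓝 0) := by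
      have := tendsto_integral_of_dominated_convergence (μ := volume)
        (F := fun n x => |φ x| *
          (|deriv F (fn n x) - deriv F (B.indicator f x)| * |B.indicator g x|))
        (f := fun _ => (0 : ℝ)) (fun x => M * (2 * C * |B.indicator g x|)) (fun n => ?_) ?_
        (fun n => ?_) ?_
      · simpa using this
      · exact (hφ.continuous.abs.aestronglyMeasurable).mul
          ((((hF'c.comp (hfnd n).continuous).aestronglyMeasurable).sub
            (hF'c.comp_aestronglyMeasurable hfB.aestronglyMeasurable)).norm.mul
              hgB.aestronglyMeasurable.norm)
      · exact (hgB.abs.const_mul _).const_mul _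
      · refine ae_of_all _ fun x => ?_
        rw [Real.norm_eq_abs, abs_of_nonneg (by positivity)]
        gcongr
        · exact hM x
        · refine (abs_sub _ _).trans ?_
          linarith [hC (fn n x), hC (B.indicator f x)]
      · filter_upwards [mollify_tendsto_ae hfB.locallyIntegrable] with x hx
        have h1 : Tendsto (fun n => deriv F (fn n x)) atTop (𝓝 (deriv F (B.indicator f x))) :=
          (hF'c.tendsto _).comp hx
        have h2 := (((h1.sub_const (deriv F (B.indicator f x))).abs).mul_const
          |B.indicator g x|).const_mul |φ x|
        simpa using h2
    rw [tendsto_iff_dist_tendsto_zero]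
    have l0 := ((tendsto_integral_abs_mollify_sub hgB).const_mul (M * C)).add hmid
    rw [mul_zero, add_zero] at l0
    refine squeeze_zero (fun n => dist_nonneg) (fun n => ?_) l0
    have hmidi : Integrable (fun x => |φ x| *
        (|deriv F (fn n x) - deriv F (B.indicator f x)| * |B.indicator g x|)) := by
      refine (((hgB.abs.const_mul (2 * C)).const_mul M)).mono' ?_ (ae_of_all _ fun x => ?_)
      · exact (hφ.continuous.abs.aestronglyMeasurable).mul
          ((((hF'c.comp (hfnd n).continuous).aestronglyMeasurable).sub
            (hF'c.comp_aestronglyMeasurable hfB.aestronglyMeasurable)).norm.mul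
              hgB.aestronglyMeasurable.norm)
      · rw [Real.norm_eq_abs, abs_of_nonneg (by positivity)]
        gcongr
        · exact hM x
        · refine (abs_sub _ _).trans ?_
          linarith [hC (fn n x), hC (B.indicator f x)]
    rw [Real.dist_eq, ← integral_sub (hgni n) hgi, ← integral_const_mul,
      ← integral_add ((hgs n).const_mul _) hmidi]
    refine abs_integral_le_integral_abs.trans
      (integral_mono ((hgni n).sub hgi).abs (((hgs n).const_mul _).add hmidi) fun x => ?_)
    by_cases hx : x ∈ B
    · simp only [hx, Set.indicator_of_mem, ← mul_sub, abs_mul]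
      have e : deriv F (fn n x) * gn n x - deriv F (f x) * g x
          = deriv F (fn n x) * (gn n x - g x) + (deriv F (fn n x) - deriv F (f x)) * g x := by ring
      calc |φ x| * |deriv F (fn n x) * gn n x - deriv F (f x) * g x|
          ≤ |φ x| * (|deriv F (fn n x)| * |gn n x - g x|
              + |deriv F (fn n x) - deriv F (f x)| * |g x|) := by
            have h3 := abs_add_le (deriv F (fn n x) * (gn n x - g x))
              ((deriv F (fn n x) - deriv F (f x)) * g x)
            rw [abs_mul, abs_mul] at h3
            rw [e]
            exact mul_le_mul_of_nonneg_left h3 (abs_nonneg _)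
        _ ≤ _ := by
            rw [mul_add, ← mul_assoc]
            exact add_le_add (mul_le_mul_of_nonneg_right
              (mul_le_mul (hM x) (hC _) (abs_nonneg _) hM0) (abs_nonneg _)) le_rfl
    · simp only [hφ0 x hx, zero_mul, sub_zero, abs_zero, add_zero]
      positivity
  exact tendsto_nhds_unique (lim1.congr hn) lim2.neg

/-- Chain rule for a pointwise limit `P` of bounded-derivative `C¹` functions `F n` whose values and
derivatives along `f` are locally dominated. -/
theorem HasWeakDeriv.comp_of_tendsto {v : E} {f g : E → ℝ} (h : HasWeakDeriv v f g)
    {F : ℕ → ℝ → ℝ} {P Q A B : ℝ → ℝ} (hF : ∀ n, ContDiff ℝ 1 (F n))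
    (hC : ∀ n, ∃ C, ∀ t, |deriv (F n) t| ≤ C)
    (hA : ∀ n t, |F n t| ≤ A t) (hB : ∀ n t, |deriv (F n) t| ≤ B t)
    (hP : ∀ t, Tendsto (fun n => F n t) atTop (𝓝 (P t)))
    (hQ : ∀ t, Tendsto (fun n => deriv (F n) t) atTop (𝓝 (Q t)))
    (hAf : LocallyIntegrable (fun x => A (f x)))
    (hBf : LocallyIntegrable (fun x => B (f x) * |g x|)) :
    HasWeakDeriv v (fun x => P (f x)) (fun x => Q (f x) * g x) := by
  have hn := fun n => (hC n).elim fun C hC => h.comp_of_deriv_bounded (hF n) hC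
  have hlimQ : ∀ x, Tendsto (fun n => deriv (F n) (f x) * g x) atTop (𝓝 (Q (f x) * g x)) :=
    fun x => (hQ (f x)).mul_const _
  have hA0 : ∀ t, 0 ≤ A t := fun t => (abs_nonneg _).trans (hA 0 t)
  have hB0 : ∀ t, 0 ≤ B t := fun t => (abs_nonneg _).trans (hB 0 t)
  have hbB : ∀ n x, |deriv (F n) (f x) * g x| ≤ B (f x) * |g x| := fun n x => by
    rw [abs_mul]; exact mul_le_mul_of_nonneg_right (hB n _) (abs_nonneg _)
  have hPl : LocallyIntegrable (fun x => P (f x)) := by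
    refine hAf.mono (aestronglyMeasurable_of_tendsto_ae atTop
      (fun n => (hn n).1.aestronglyMeasurable) (ae_of_all _ fun x => hP (f x)))
      (ae_of_all _ fun x => ?_)
    rw [Real.norm_eq_abs, Real.norm_eq_abs, abs_of_nonneg (hA0 _)]
    exact le_of_tendsto (hP (f x)).abs (Eventually.of_forall fun n => hA n _)
  have hQl : LocallyIntegrable (fun x => Q (f x) * g x) := by
    refine hBf.mono (aestronglyMeasurable_of_tendsto_ae atTop
      (fun n => (hn n).2.1.aestronglyMeasurable) (ae_of_all _ hlimQ)) (ae_of_all _ fun x => ?_)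
    rw [Real.norm_eq_abs, Real.norm_eq_abs,
      abs_of_nonneg (a := B (f x) * _) (mul_nonneg (hB0 _) (abs_nonneg _))]
    exact le_of_tendsto (hlimQ x).abs (Eventually.of_forall fun n => hbB n x)
  refine ⟨hPl, hQl, fun φ hφ hφc => ?_⟩
  have hdφ : Continuous (fun x => fderiv ℝ φ x v) :=
    (hφ.continuous_fderiv (by simp)).clm_apply continuous_const
  have hdφc : HasCompactSupport (fun x => fderiv ℝ φ x v) := hφc.fderiv_apply ℝ v
  have lim1 : Tendsto (fun n => ∫ x, F n (f x) * fderiv ℝ φ x v) atTop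
      (𝓝 (∫ x, P (f x) * fderiv ℝ φ x v)) := by
    refine tendsto_integral_of_dominated_convergence (fun x => A (f x) * |fderiv ℝ φ x v|)
      (fun n => (hn n).1.aestronglyMeasurable.mul hdφ.aestronglyMeasurable)
      (hAf.integrable_smul_right_of_hasCompactSupport hdφ.abs hdφc.norm)
      (fun n => ae_of_all _ fun x => ?_) (ae_of_all _ fun x => (hP (f x)).mul_const _)
    rw [Real.norm_eq_abs, abs_mul]
    exact mul_le_mul_of_nonneg_right (hA n _) (abs_nonneg _)
  have lim2 : Tendsto (fun n => ∫ x, φ x * (deriv (F n) (f x) * g x)) atTop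
      (𝓝 (∫ x, φ x * (Q (f x) * g x))) := by
    refine tendsto_integral_of_dominated_convergence (fun x => |φ x| * (B (f x) * |g x|))
      (fun n => hφ.continuous.aestronglyMeasurable.mul (hn n).2.1.aestronglyMeasurable)
      (hBf.integrable_smul_left_of_hasCompactSupport hφ.continuous.abs hφc.norm)
      (fun n => ae_of_all _ fun x => ?_) (ae_of_all _ fun x => (hlimQ x).const_mul _)
    rw [Real.norm_eq_abs, abs_mul]
    exact mul_le_mul_of_nonneg_left (hbB n x) (abs_nonneg _)
  exact tendsto_nhds_unique (lim1.congr fun n => (hn n).2.2 φ hφ hφc) lim2.neg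

/-! ### Regularized powers -/

/-- A `C¹` regularization of `|t| ^ q` with bounded derivative: `δ` keeps the base of the power away
from `0`, and `t ^ 2 / (1 + δ * t ^ 2)` is bounded by `1 / δ`. -/
noncomputable def regPow (q δ t : ℝ) : ℝ := (t ^ 2 / (1 + δ * t ^ 2) + δ) ^ (q / 2)

theorem regPow_base_pos {δ : ℝ} (hδ : 0 < δ) (t : ℝ) : 0 < t ^ 2 / (1 + δ * t ^ 2) + δ := by
  positivity

theorem contDiff_regPow (q : ℝ) {δ : ℝ} (hδ : 0 < δ) : ContDiff ℝ 1 (regPow q δ) := by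
  refine ContDiff.rpow_const_of_ne ?_ fun t => (regPow_base_pos hδ t).ne'
  refine (ContDiff.div (by fun_prop) (by fun_prop) fun t => ?_).add contDiff_const
  positivity

theorem deriv_regPow (q : ℝ) {δ : ℝ} (hδ : 0 < δ) (t : ℝ) :
    deriv (regPow q δ) t =
      q * (t ^ 2 / (1 + δ * t ^ 2) + δ) ^ (q / 2 - 1) * (t / (1 + δ * t ^ 2) ^ 2) := by
  have hne : 1 + δ * t ^ 2 ≠ 0 := by positivity
  have h1 : HasDerivAt (fun t : ℝ => t ^ 2 / (1 + δ * t ^ 2) + δ)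
      (2 * t / (1 + δ * t ^ 2) ^ 2) t := by
    have := (((hasDerivAt_id t).pow 2).div
      ((((hasDerivAt_id t).pow 2).const_mul δ).const_add 1) hne).add_const δ
    refine this.congr_deriv ?_
    simp only [id_eq, Pi.pow_apply]
    field_simp
    ring
  have h2 := (h1.rpow_const (p := q / 2) (Or.inl (regPow_base_pos hδ t).ne')).deriv
  unfold regPow
  rw [h2]
  ring

theorem abs_deriv_regPow {q δ : ℝ} (hq : 0 < q) (hδ : 0 < δ) (t : ℝ) :
    |deriv (regPow q δ) t| =
      q * (t ^ 2 / (1 + δ * t ^ 2) + δ) ^ (q / 2 - 1) * (|t| / (1 + δ * t ^ 2) ^ 2) := by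
  have := regPow_base_pos hδ t
  rw [deriv_regPow q hδ, abs_mul, abs_div, abs_of_nonneg (a := (1 + δ * t ^ 2) ^ 2) (by positivity),
    abs_of_nonneg (a := q * _) (by positivity)]

theorem exists_abs_deriv_regPow_le {q δ : ℝ} (hq : 0 < q) (hδ : 0 < δ) (hδ1 : δ ≤ 1) :
    ∃ C, ∀ t, |deriv (regPow q δ) t| ≤ C := by
  refine ⟨q * (δ ^ (q / 2 - 1) + (1 / δ + δ) ^ (q / 2 - 1)) * (1 / δ), fun t => ?_⟩
  rw [abs_deriv_regPow hq hδ]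
  have hb := regPow_base_pos hδ t
  have hD : 0 < 1 + δ * t ^ 2 := by positivity
  have h0 : 0 ≤ t ^ 2 / (1 + δ * t ^ 2) := by positivity
  have hle : t ^ 2 / (1 + δ * t ^ 2) ≤ 1 / δ := by
    rw [div_le_div_iff₀ hD hδ]; linarith
  refine mul_le_mul (mul_le_mul_of_nonneg_left ?_ hq.le) ?_ (by positivity) (by positivity)
  · rcases le_total 0 (q / 2 - 1) with he | he
    · refine le_add_of_nonneg_of_le (by positivity) ?_
      exact Real.rpow_le_rpow hb.le (by linarith) he
    · refine le_add_of_le_of_nonneg ?_ (by positivity)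
      exact Real.rpow_le_rpow_of_nonpos hδ (by linarith) he
  · rw [div_le_div_iff₀ (by positivity) hδ]
    have h1 : |t| * δ ≤ 1 + δ * t ^ 2 := by
      have : |t| ≤ 1 + t ^ 2 := by
        rw [← sq_abs]; nlinarith [sq_nonneg (|t| - 1), abs_nonneg t]
      nlinarith
    nlinarith [mul_nonneg hδ.le (sq_nonneg t)]

theorem abs_regPow_le {q δ : ℝ} (hq : 0 < q) (hδ : 0 < δ) (hδ1 : δ ≤ 1) (t : ℝ) :
    |regPow q δ t| ≤ 2 ^ (q / 2) * (1 + |t| ^ q) := by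
  have hb := regPow_base_pos hδ t
  have hle : t ^ 2 / (1 + δ * t ^ 2) ≤ t ^ 2 :=
    div_le_self (sq_nonneg t) (by nlinarith [mul_nonneg hδ.le (sq_nonneg t)])
  have hq2 : 0 ≤ q / 2 := by positivity
  have ht : 0 ≤ |t| ^ q := by positivity
  unfold regPow
  rw [abs_of_nonneg (by positivity)]
  rcases le_total (|t|) 1 with h1 | h1
  · have : t ^ 2 ≤ 1 := by rw [← sq_abs]; nlinarith [abs_nonneg t]
    calc _ ≤ (2 : ℝ) ^ (q / 2) := Real.rpow_le_rpow hb.le (by linarith) hq2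
      _ ≤ _ := le_mul_of_one_le_right (by positivity) (by linarith)
  · have : 1 ≤ t ^ 2 := by rw [← sq_abs]; nlinarith [abs_nonneg t]
    calc _ ≤ (2 * |t| ^ (2 : ℝ)) ^ (q / 2) := by
          refine Real.rpow_le_rpow hb.le ?_ hq2
          rw [Real.rpow_two, sq_abs]; linarith
      _ = 2 ^ (q / 2) * |t| ^ q := by
          rw [Real.mul_rpow (by norm_num) (by positivity), ← Real.rpow_mul (abs_nonneg t)]
          congr 2; ring
      _ ≤ _ := by gcongr; linarith

theorem abs_deriv_regPow_le {q δ : ℝ} (hq : 0 < q) (hδ : 0 < δ) (hδ1 : δ ≤ 1) (t : ℝ) :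
    |deriv (regPow q δ) t| ≤ q * 2 ^ (q / 2) * (1 + |(|t| ^ (q - 2) * t)|) := by
  rw [abs_deriv_regPow hq hδ, abs_mul (|t| ^ (q - 2)), abs_of_nonneg (a := |t| ^ (q - 2))
    (by positivity)]
  rcases eq_or_ne t 0 with rfl | ht0
  · simp; positivity
  have ht : 0 < |t| := abs_pos.2 ht0
  have hb := regPow_base_pos hδ t
  have hD : 1 ≤ 1 + δ * t ^ 2 := by nlinarith [mul_nonneg hδ.le (sq_nonneg t)]
  have hD0 : 0 < 1 + δ * t ^ 2 := by positivity
  have hle : t ^ 2 / (1 + δ * t ^ 2) ≤ t ^ 2 := div_le_self (sq_nonneg t) hD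
  have h2 : (1 : ℝ) ≤ 2 ^ (q / 2) := Real.one_le_rpow (by norm_num) (by positivity)
  have hmain : (t ^ 2 / (1 + δ * t ^ 2) + δ) ^ (q / 2 - 1) * (|t| / (1 + δ * t ^ 2) ^ 2)
      ≤ 2 ^ (q / 2) * (1 + |t| ^ (q - 2) * |t|) := by
    have hpow : ∀ s : ℝ, (|t| ^ (2 : ℝ)) ^ (s / 2 - 1) = |t| ^ (s - 2) := fun s => by
      rw [← Real.rpow_mul ht.le]; congr 1; ring
    rcases le_total 2 q with hq2 | hq2
    · have he : 0 ≤ q / 2 - 1 := by linarith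
      have hmono : (2 : ℝ) ^ (q / 2 - 1) ≤ 2 ^ (q / 2) :=
        Real.rpow_le_rpow_of_exponent_le (by norm_num) (by linarith)
      have hdiv : |t| / (1 + δ * t ^ 2) ^ 2 ≤ |t| := div_le_self ht.le (one_le_pow₀ hD)
      rcases le_total (|t|) 1 with h1 | h1
      · have : t ^ 2 ≤ 1 := by rw [← sq_abs]; nlinarith
        calc _ ≤ (2 : ℝ) ^ (q / 2 - 1) * 1 := by
              gcongr
              · linarith
              · linarith
          _ ≤ 2 ^ (q / 2) * (1 + |t| ^ (q - 2) * |t|) := by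
              gcongr
              exact le_add_of_nonneg_right (by positivity)
      · have : 1 ≤ t ^ 2 := by rw [← sq_abs]; nlinarith
        calc _ ≤ (2 * |t| ^ (2 : ℝ)) ^ (q / 2 - 1) * |t| := by
              gcongr
              rw [Real.rpow_two, sq_abs]; linarith
          _ = 2 ^ (q / 2 - 1) * (|t| ^ (q - 2) * |t|) := by
              rw [Real.mul_rpow (by norm_num) (by positivity), hpow, mul_assoc]
          _ ≤ _ := by
              gcongr
              linarith
    -- for `q < 2` the negative power is absorbed by the factor `(1 + δ t²)⁻²` of the derivative
    · have he : q / 2 - 1 ≤ 0 := by linarith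
      have hm0 : 0 < t ^ 2 / (1 + δ * t ^ 2) := by positivity
      have e1 : (t ^ 2 / (1 + δ * t ^ 2)) ^ (q / 2 - 1)
          = |t| ^ (q - 2) * (1 + δ * t ^ 2) ^ (1 - q / 2) := by
        rw [Real.div_rpow (sq_nonneg t) hD0.le, ← sq_abs t, ← Real.rpow_two |t|, hpow,
          div_eq_mul_inv, ← Real.rpow_neg (by positivity)]
        congr 2; ring
      have e2 : (1 + δ * t ^ 2) ^ (1 - q / 2) ≤ (1 + δ * t ^ 2) ^ (2 : ℕ) := by
        rw [← Real.rpow_natCast (1 + δ * t ^ 2)]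
        exact Real.rpow_le_rpow_of_exponent_le hD (by push_cast; linarith)
      calc _ ≤ (|t| ^ (q - 2) * (1 + δ * t ^ 2) ^ (2 : ℕ)) * (|t| / (1 + δ * t ^ 2) ^ 2) := by
            gcongr
            refine (Real.rpow_le_rpow_of_nonpos hm0 (by linarith) he).trans ?_
            rw [e1]
            gcongr
        _ = |t| ^ (q - 2) * |t| := by field_simp
        _ ≤ 1 * (1 + |t| ^ (q - 2) * |t|) := by linarith
        _ ≤ _ := by gcongr
  calc _ = q * ((t ^ 2 / (1 + δ * t ^ 2) + δ) ^ (q / 2 - 1) * (|t| / (1 + δ * t ^ 2) ^ 2)) := by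
        ring
    _ ≤ q * (2 ^ (q / 2) * (1 + |t| ^ (q - 2) * |t|)) := by gcongr
    _ = _ := by ring

theorem sq_rpow_half (t s : ℝ) : (t ^ 2) ^ (s / 2) = |t| ^ s := by
  rw [← sq_abs, ← Real.rpow_two, ← Real.rpow_mul (abs_nonneg t)]
  congr 1; ring

theorem tendsto_regPow_base (t : ℝ) {δ : ℕ → ℝ} (hδ : Tendsto δ atTop (𝓝 0)) :
    Tendsto (fun n => t ^ 2 / (1 + δ n * t ^ 2) + δ n) atTop (𝓝 (t ^ 2)) := by
  have h1 : Tendsto (fun n => 1 + δ n * t ^ 2) atTop (𝓝 1) := by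
    simpa using (hδ.mul_const (t ^ 2)).const_add 1
  simpa using ((tendsto_const_nhds (x := t ^ 2)).div h1 one_ne_zero).add hδ

theorem tendsto_regPow {q : ℝ} (hq : 0 < q) (t : ℝ) {δ : ℕ → ℝ} (hδ : Tendsto δ atTop (𝓝 0)) :
    Tendsto (fun n => regPow q (δ n) t) atTop (𝓝 (|t| ^ q)) := by
  rw [← sq_rpow_half]
  exact (tendsto_regPow_base t hδ).rpow_const (Or.inr (by positivity))

theorem tendsto_deriv_regPow (q t : ℝ) {δ : ℕ → ℝ} (hδ0 : ∀ n, 0 < δ n)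
    (hδ : Tendsto δ atTop (𝓝 0)) :
    Tendsto (fun n => deriv (regPow q (δ n)) t) atTop (𝓝 (q * (|t| ^ (q - 2) * t))) := by
  simp_rw [fun n => deriv_regPow q (hδ0 n) t]
  rcases eq_or_ne t 0 with rfl | ht0
  · simp
  have h1 : Tendsto (fun n => (1 + δ n * t ^ 2) ^ 2) atTop (𝓝 1) := by
    simpa using ((hδ.mul_const (t ^ 2)).const_add 1).pow 2
  have h2 := (((tendsto_regPow_base t hδ).rpow_const (p := q / 2 - 1)
    (Or.inl (by positivity))).const_mul q).mul
      ((tendsto_const_nhds (x := t)).div h1 one_ne_zero)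
  have e : q * (|t| ^ (q - 2) * t) = q * (t ^ 2) ^ (q / 2 - 1) * (t / 1) := by
    rw [show q / 2 - 1 = (q - 2) / 2 by ring, sq_rpow_half]
    ring
  rw [e]
  exact h2

/-- Weak differentiability of `|f| ^ q` for every `q > 0`, as soon as the expected derivative is
locally integrable. -/
theorem HasWeakDeriv.abs_rpow {v : E} {f g : E → ℝ} (h : HasWeakDeriv v f g) {q : ℝ} (hq : 0 < q)
    (h1 : LocallyIntegrable (fun x => |f x| ^ q))
    (h2 : LocallyIntegrable (fun x => |f x| ^ (q - 2) * f x * g x)) :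
    HasWeakDeriv v (fun x => |f x| ^ q) (fun x => q * (|f x| ^ (q - 2) * f x) * g x) := by
  set δ : ℕ → ℝ := fun n => 1 / ((n : ℝ) + 1) with hδdef
  have hδ0 : ∀ n, 0 < δ n := fun n => by positivity
  have hδ1 : ∀ n, δ n ≤ 1 := fun n => by
    rw [hδdef]
    simp only
    rw [div_le_one (by positivity)]; linarith [(n.cast_nonneg : (0 : ℝ) ≤ n)]
  have hδ : Tendsto δ atTop (𝓝 0) := tendsto_one_div_add_atTop_nhds_zero_nat
  refine h.comp_of_tendsto (P := fun t => |t| ^ q) (Q := fun t => q * (|t| ^ (q - 2) * t))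
    (fun n => contDiff_regPow q (hδ0 n)) (fun n => exists_abs_deriv_regPow_le hq (hδ0 n) (hδ1 n))
    (fun n t => abs_regPow_le hq (hδ0 n) (hδ1 n) t)
    (fun n t => abs_deriv_regPow_le hq (hδ0 n) (hδ1 n) t)
    (fun t => tendsto_regPow hq t hδ) (fun t => tendsto_deriv_regPow q t hδ0 hδ) ?_ ?_
  · exact (continuous_const.locallyIntegrable.add h1).smul ((2 : ℝ) ^ (q / 2))
  · have := ((locallyIntegrable_abs h.2.1).add (locallyIntegrable_abs h2)).smul
      (q * (2 : ℝ) ^ (q / 2))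
    convert this using 1
    ext x
    simp only [Pi.smul_apply, Pi.add_apply, smul_eq_mul, abs_mul]
    ring

/-! ### Linearity and the product rule -/

theorem HasWeakDeriv.add {v : E} {f g f' g' : E → ℝ} (hf : HasWeakDeriv v f f')
    (hg : HasWeakDeriv v g g') :
    HasWeakDeriv v (fun x => f x + g x) (fun x => f' x + g' x) := by
  refine ⟨hf.1.add hg.1, hf.2.1.add hg.2.1, fun φ hφ hφc => ?_⟩
  have hdφ : Continuous (fun x => fderiv ℝ φ x v) :=
    (hφ.continuous_fderiv (by simp)).clm_apply continuous_const
  have hdφc : HasCompactSupport (fun x => fderiv ℝ φ x v) := hφc.fderiv_apply ℝ v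
  simp only [add_mul, mul_add]
  have e1 := integral_add (hf.1.integrable_smul_right_of_hasCompactSupport hdφ hdφc)
    (hg.1.integrable_smul_right_of_hasCompactSupport hdφ hdφc)
  have e2 := integral_add (hf.2.1.integrable_smul_left_of_hasCompactSupport hφ.continuous hφc)
    (hg.2.1.integrable_smul_left_of_hasCompactSupport hφ.continuous hφc)
  simp only [smul_eq_mul] at e1 e2
  rw [e1, e2, hf.2.2 φ hφ hφc, hg.2.2 φ hφ hφc]
  ring

theorem HasWeakDeriv.const_mul {v : E} {f f' : E → ℝ} (hf : HasWeakDeriv v f f') (c : ℝ) :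
    HasWeakDeriv v (fun x => c * f x) (fun x => c * f' x) := by
  refine ⟨hf.1.smul c, hf.2.1.smul c, fun φ hφ hφc => ?_⟩
  have h1 : ∀ x, φ x * (c * f' x) = c * (φ x * f' x) := fun x => by ring
  simp only [mul_assoc, h1]
  rw [integral_const_mul, integral_const_mul, hf.2.2 φ hφ hφc, mul_neg]

/-- Square integrability on compact sets. -/
def MemL2Loc (f : E → ℝ) : Prop :=
  ∀ K : Set E, IsCompact K → MemLp f 2 (volume.restrict K)

theorem MemL2Loc.add {f g : E → ℝ} (hf : MemL2Loc f) (hg : MemL2Loc g) :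
    MemL2Loc (fun x => f x + g x) := fun K hK => (hf K hK).add (hg K hK)

theorem MemL2Loc.locallyIntegrable_mul {f g : E → ℝ} (hf : MemL2Loc f) (hg : MemL2Loc g) :
    LocallyIntegrable (fun x => f x * g x) :=
  locallyIntegrable_iff.2 fun K hK => (hf K hK).integrable_mul (hg K hK)

theorem HasWeakDeriv.sq {v : E} {f f' : E → ℝ} (h : HasWeakDeriv v f f') (hf : MemL2Loc f)
    (hf' : MemL2Loc f') : HasWeakDeriv v (fun x => f x * f x) (fun x => 2 * (f x * f' x)) := by
  have := h.abs_rpow (q := 2) two_pos (by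
    simpa [← pow_two] using hf.locallyIntegrable_mul hf) (by
    simpa using hf.locallyIntegrable_mul hf')
  simpa [mul_assoc, ← pow_two] using this

/-- The product rule, by polarization of the rule for squares. -/
theorem HasWeakDeriv.mul {v : E} {f g f' g' : E → ℝ} (hf : HasWeakDeriv v f f')
    (hg : HasWeakDeriv v g g') (hf2 : MemL2Loc f) (hg2 : MemL2Loc g) (hf2' : MemL2Loc f')
    (hg2' : MemL2Loc g') :
    HasWeakDeriv v (fun x => f x * g x) (fun x => f x * g' x + f' x * g x) := by
  have h := (((hf.add hg).sq (hf2.add hg2) (hf2'.add hg2')).add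
    (((hf.sq hf2 hf2').add (hg.sq hg2 hg2')).const_mul (-1))).const_mul (1 / 2)
  convert h using 2 <;> ring

end WeakDerivatives

section EuclideanSpace

variable {N : ℕ}

local notation "𝔼" => EuclideanSpace ℝ (Fin N)

/-! ### Weak gradients in coordinates -/

/-- The `i`-th standard basis vector. -/
noncomputable abbrev stdVec (i : Fin N) : 𝔼 := EuclideanSpace.single i (1 : ℝ)

/-- The divergence `∑ ∂ᵢ Xᵢ` of a vector field. -/
noncomputable def divergence (X : 𝔼 → 𝔼) (x : 𝔼) : ℝ := ∑ i, fderiv ℝ X x (stdVec i) i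

theorem gradient_apply (φ : 𝔼 → ℝ) (x : 𝔼) (i : Fin N) :
    ∇ φ x i = fderiv ℝ φ x (stdVec i) := by
  rw [← inner_gradient_left, stdVec, EuclideanSpace.inner_single_right]
  simp

theorem locallyIntegrable_coord {G : 𝔼 → 𝔼} (hG : LocallyIntegrable G) (i : Fin N) :
    LocallyIntegrable (fun x => G x i) :=
  locallyIntegrable_iff.2 fun _ hK =>
    (EuclideanSpace.proj (𝕜 := ℝ) i).integrable_comp (hG.integrableOn_isCompact hK)

theorem IsWeakGradient.hasWeakDeriv {u : 𝔼 → ℝ} {G : 𝔼 → 𝔼} (h : IsWeakGradient u G)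
    (i : Fin N) : HasWeakDeriv (stdVec i) u (fun x => G x i) := by
  refine ⟨h.1, locallyIntegrable_coord h.2.1 i, fun φ hφ hφc => ?_⟩
  have hgc : Continuous (∇ φ) :=
    (InnerProductSpace.toDual ℝ 𝔼).symm.continuous.comp (hφ.continuous_fderiv (by simp))
  have hgs : HasCompactSupport (∇ φ) :=
    (hφc.fderiv ℝ).comp_left (g := (InnerProductSpace.toDual ℝ 𝔼).symm) (map_zero _)
  have h1 := (EuclideanSpace.proj (𝕜 := ℝ) i).integral_comp_comm
    (h.1.integrable_smul_right_of_hasCompactSupport hgc hgs)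
  have h2 := (EuclideanSpace.proj (𝕜 := ℝ) i).integral_comp_comm
    (h.2.1.integrable_smul_left_of_hasCompactSupport hφ.continuous hφc)
  rw [h.2.2 φ hφ hφc, map_neg, ← h2] at h1
  simpa [gradient_apply] using h1

theorem IsWeakGradient.ae_eq {u : 𝔼 → ℝ} {G G' : 𝔼 → 𝔼} (h : IsWeakGradient u G)
    (h' : IsWeakGradient u G') : G =ᵐ[volume] G' :=
  ae_eq_of_integral_contDiff_smul_eq h.2.1 h'.2.1 fun φ hφ hφc =>
    neg_injective ((h.2.2 φ hφ hφc).symm.trans (h'.2.2 φ hφ hφc))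

/-- Weak second derivatives commute. -/
theorem ae_eq_of_hasWeakDeriv_comm {v w : 𝔼} {u g₁ g₂ h₁ h₂ : 𝔼 → ℝ} (hv : HasWeakDeriv v u g₁)
    (hw : HasWeakDeriv w u g₂) (hvw : HasWeakDeriv w g₁ h₁) (hwv : HasWeakDeriv v g₂ h₂) :
    h₁ =ᵐ[volume] h₂ := by
  refine ae_eq_of_integral_contDiff_smul_eq hvw.2.1 hwv.2.1 fun φ hφ hφc => ?_
  have hd : ∀ z : 𝔼, ContDiff ℝ ∞ (fun x => fderiv ℝ φ x z) := fun z =>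
    (hφ.fderiv_right (m := ∞) (by simp)).clm_apply contDiff_const
  have hdc : ∀ z : 𝔼, HasCompactSupport (fun x => fderiv ℝ φ x z) := fun z => hφc.fderiv_apply ℝ z
  have h2 : ∀ (x z y : 𝔼), fderiv ℝ (fun x => fderiv ℝ φ x z) x y
      = fderiv ℝ (fderiv ℝ φ) x y z := fun x z y => by
    have hdd : DifferentiableAt ℝ (fderiv ℝ φ) x :=
      (hφ.fderiv_right (m := ∞) (by simp)).differentiable (by simp) x
    rw [fderiv_clm_apply hdd (differentiableAt_const z)]
    simp
  have key : ∀ (a b : 𝔼) (g h : 𝔼 → ℝ), HasWeakDeriv a u g → HasWeakDeriv b g h →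
      ∫ x, φ x • h x = ∫ x, u x * fderiv ℝ (fderiv ℝ φ) x a b := fun a b g h ha hb => by
    have e1 := hb.2.2 φ hφ hφc
    have e2 := ha.2.2 _ (hd b) (hdc b)
    simp only [h2] at e2
    simp only [smul_eq_mul]
    rw [e2, ← neg_inj, ← e1, neg_neg]
    exact integral_congr_ae (ae_of_all _ fun x => mul_comm _ _)
  rw [key v w g₁ h₁ hv hvw, key w v g₂ h₂ hw hwv]
  refine integral_congr_ae (ae_of_all _ fun x => ?_)
  have := (hφ.contDiffAt (x := x)).isSymmSndFDerivAt (by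
    rw [minSmoothness_of_isRCLikeNormedField]
    exact WithTop.coe_le_coe.2 (le_top : (2 : ℕ∞) ≤ ⊤)) v w
  simp only [this]

/-! ### Testing against vector fields -/

theorem fderiv_coord {X : 𝔼 → 𝔼} {x : 𝔼} (hX : DifferentiableAt ℝ X x) (v : 𝔼) (i : Fin N) :
    fderiv ℝ (fun x => X x i) x v = fderiv ℝ X x v i := by
  have := ((EuclideanSpace.proj (𝕜 := ℝ) i).hasFDerivAt.comp x hX.hasFDerivAt).fderiv
  change fderiv ℝ (fun x => X x i) x = _ at this
  rw [this]; rfl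

theorem contDiff_coord {X : 𝔼 → 𝔼} (hX : ContDiff ℝ ∞ X) (i : Fin N) :
    ContDiff ℝ ∞ (fun x => X x i) := (EuclideanSpace.proj (𝕜 := ℝ) i).contDiff.comp hX

theorem hasCompactSupport_coord {X : 𝔼 → 𝔼} (hX : HasCompactSupport X) (i : Fin N) :
    HasCompactSupport (fun x => X x i) := hX.comp_left (g := fun y : 𝔼 => y i) (by simp)

/-- A weak derivative tested against one coordinate of a vector field. -/
theorem HasWeakDeriv.integral_mul_fderiv_coord {v : 𝔼} {b w : 𝔼 → ℝ} (h : HasWeakDeriv v b w)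
    {X : 𝔼 → 𝔼} (hX : ContDiff ℝ ∞ X) (hXc : HasCompactSupport X) (j : Fin N) :
    ∫ x, b x * fderiv ℝ X x v j = - ∫ x, X x j * w x := by
  have := h.2.2 _ (contDiff_coord hX j) (hasCompactSupport_coord hXc j)
  simpa only [fderiv_coord (hX.differentiable (by simp) _)] using this

theorem continuous_fderiv_coord {X : 𝔼 → 𝔼} (hX : ContDiff ℝ ∞ X) (v : 𝔼) (j : Fin N) :
    Continuous (fun x => fderiv ℝ X x v j) :=
  (EuclideanSpace.proj (𝕜 := ℝ) j).continuous.comp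
    ((hX.continuous_fderiv (by simp)).clm_apply continuous_const)

theorem hasCompactSupport_fderiv_coord {X : 𝔼 → 𝔼} (hXc : HasCompactSupport X) (v : 𝔼)
    (j : Fin N) : HasCompactSupport (fun x => fderiv ℝ X x v j) :=
  hasCompactSupport_coord (hXc.fderiv_apply ℝ v) j

theorem continuous_divergence {X : 𝔼 → 𝔼} (hX : ContDiff ℝ ∞ X) : Continuous (divergence X) :=
  continuous_finsetSum _ fun i _ => continuous_fderiv_coord hX _ i

theorem hasCompactSupport_divergence {X : 𝔼 → 𝔼} (hXc : HasCompactSupport X) :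
    HasCompactSupport (divergence X) :=
  (hXc.fderiv ℝ).comp_left (g := fun L : 𝔼 →L[ℝ] 𝔼 => ∑ i, L (stdVec i) i) (by simp)

/-- The divergence theorem for a weakly differentiable function and a test vector field. -/
theorem integral_mul_divergence {b : 𝔼 → ℝ} {w : Fin N → 𝔼 → ℝ}
    (h : ∀ i, HasWeakDeriv (stdVec i) b (w i)) {X : 𝔼 → 𝔼} (hX : ContDiff ℝ ∞ X)
    (hXc : HasCompactSupport X) (hb : LocallyIntegrable b) :
    ∫ x, b x * divergence X x = - ∫ x, ∑ i, X x i * w i x := by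
  simp only [divergence, Finset.mul_sum]
  rw [integral_finsetSum, integral_finsetSum, ← Finset.sum_neg_distrib]
  · exact Finset.sum_congr rfl fun i _ => (h i).integral_mul_fderiv_coord hX hXc i
  · exact fun i _ => (h i).2.1.integrable_smul_left_of_hasCompactSupport
      (contDiff_coord hX i).continuous (hasCompactSupport_coord hXc i)
  · exact fun i _ => hb.integrable_smul_right_of_hasCompactSupport
      (continuous_fderiv_coord hX _ i) (hasCompactSupport_fderiv_coord hXc _ i)

/-! ### The linear terms -/

/-- Testing `u - Δu` against `χ u`. -/
theorem integral_sub_laplacian_mul_self {u : 𝔼 → ℝ} {g : Fin N → 𝔼 → ℝ}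
    {h : Fin N → Fin N → 𝔼 → ℝ} (hu : ∀ i, HasWeakDeriv (stdVec i) u (g i))
    (hg : ∀ j i, HasWeakDeriv (stdVec i) (g j) (h j i)) (hu2 : MemL2Loc u)
    (hg2 : ∀ i, MemL2Loc (g i)) (hh2 : ∀ j i, MemL2Loc (h j i)) {χ : 𝔼 → ℝ}
    (hχ : ContDiff ℝ ∞ χ) (hχc : HasCompactSupport χ) :
    ∫ x, χ x * ((u x - ∑ i, h i i x) * u x) =
      (∫ x, χ x * (u x * u x)) + (∫ x, χ x * ∑ i, g i x * g i x)
        + ∫ x, ∑ i, u x * g i x * fderiv ℝ χ x (stdVec i) := by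
  have hp : ∀ i, HasWeakDeriv (stdVec i) (fun x => u x * g i x)
      (fun x => u x * h i i x + g i x * g i x) := fun i =>
    (hu i).mul (hg i i) hu2 (hg2 i) (hg2 i) (hh2 i i)
  have hL : ∀ {f : 𝔼 → ℝ}, LocallyIntegrable f → Integrable (fun x => χ x * f x) := fun hf =>
    hf.integrable_smul_left_of_hasCompactSupport hχ.continuous hχc
  have i1 : ∀ i, Integrable fun x => u x * g i x * fderiv ℝ χ x (stdVec i) := fun i =>
    (hp i).1.integrable_smul_right_of_hasCompactSupport
      ((hχ.continuous_fderiv (by simp)).clm_apply continuous_const) (hχc.fderiv_apply ℝ _)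
  have i2 := fun i => hL (hp i).2.1
  have i3 := hL (hu2.locallyIntegrable_mul hu2)
  have i4 := fun i => hL ((hg2 i).locallyIntegrable_mul (hg2 i))
  rw [integral_finsetSum _ fun i _ => i1 i]
  simp only [fun i => (hp i).2.2 χ hχ hχc]
  rw [Finset.sum_neg_distrib, ← integral_finsetSum _ fun i _ => i2 i]
  simp only [Finset.mul_sum]
  have i4' := integrable_finsetSum Finset.univ fun i _ => i4 i
  have i2' := integrable_finsetSum Finset.univ fun i _ => i2 i
  have e := integral_sub (i3.add i4') i2'
  simp only [Pi.add_apply] at e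
  rw [← integral_add i3 i4', ← sub_eq_add_neg, ← e]
  refine integral_congr_ae (ae_of_all _ fun x => ?_)
  simp only [mul_add, Finset.sum_add_distrib, sub_mul, mul_sub, Finset.mul_sum,
    Finset.sum_mul]
  have : ∀ i, χ x * (h i i x * u x) = χ x * (u x * h i i x) := fun i => by ring
  simp only [this]
  ring

/-- The Pohozaev identity of the linear part: testing `u - Δu` against `V · ∇u`. -/
theorem integral_sub_laplacian_mul_field {u : 𝔼 → ℝ} {g : Fin N → 𝔼 → ℝ}
    {h : Fin N → Fin N → 𝔼 → ℝ} (hu : ∀ i, HasWeakDeriv (stdVec i) u (g i))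
    (hg : ∀ j i, HasWeakDeriv (stdVec i) (g j) (h j i)) (hu2 : MemL2Loc u)
    (hg2 : ∀ i, MemL2Loc (g i)) (hh2 : ∀ j i, MemL2Loc (h j i)) {V : 𝔼 → 𝔼}
    (hV : ContDiff ℝ ∞ V) (hVc : HasCompactSupport V) :
    ∫ x, (u x - ∑ i, h i i x) * ∑ j, V x j * g j x =
      - (1 / 2) * (∫ x, u x * u x * divergence V x)
        - (1 / 2) * (∫ x, (∑ j, g j x * g j x) * divergence V x)
        + ∫ x, ∑ i, ∑ j, g i x * g j x * fderiv ℝ V x (stdVec i) j := by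
  have hL : ∀ {f : 𝔼 → ℝ} (j : Fin N), LocallyIntegrable f → Integrable (fun x => V x j * f x) :=
    fun j hf => hf.integrable_smul_left_of_hasCompactSupport (contDiff_coord hV j).continuous
      (hasCompactSupport_coord hVc j)
  have hL' : ∀ {f : 𝔼 → ℝ} (i j : Fin N), LocallyIntegrable f →
      Integrable (fun x => f x * fderiv ℝ V x (stdVec i) j) :=
    fun i j hf => hf.integrable_smul_right_of_hasCompactSupport (continuous_fderiv_coord hV _ j)
      (hasCompactSupport_fderiv_coord hVc _ j)
  have hLd : ∀ {f : 𝔼 → ℝ}, LocallyIntegrable f →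
      Integrable (fun x => f x * divergence V x) :=
    fun hf => hf.integrable_smul_right_of_hasCompactSupport (continuous_divergence hV)
      (hasCompactSupport_divergence hVc)
  have lug := fun i => hu2.locallyIntegrable_mul (hg2 i)
  have lgg := fun i j => (hg2 i).locallyIntegrable_mul (hg2 j)
  have lgh := fun i j k => (hg2 i).locallyIntegrable_mul (hh2 j k)
  have lhg := fun i j k => (hh2 i j).locallyIntegrable_mul (hg2 k)
  have hsymm : ∀ i j, h i j =ᵐ[volume] h j i := fun i j =>
    ae_eq_of_hasWeakDeriv_comm (hu i) (hu j) (hg i j) (hg j i)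
  have hA : ∫ x, u x * u x * divergence V x = - (2 * ∫ x, ∑ i, V x i * (u x * g i x)) := by
    rw [integral_mul_divergence (fun i => (hu i).sq hu2 (hg2 i)) hV hVc
      (hu2.locallyIntegrable_mul hu2), ← integral_const_mul]
    congr 1
    refine integral_congr_ae (ae_of_all _ fun x => ?_)
    simp only [Finset.mul_sum]
    exact Finset.sum_congr rfl fun i _ => by ring
  have hB : ∫ x, (∑ j, g j x * g j x) * divergence V x
      = - (2 * ∫ x, ∑ j, ∑ i, V x i * (g j x * h j i x)) := by
    simp only [Finset.sum_mul]
    rw [integral_finsetSum _ fun j _ => hLd (lgg j j), integral_finsetSum _ fun j _ =>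
      integrable_finsetSum _ fun i _ => hL i (lgh j j i), Finset.mul_sum,
      ← Finset.sum_neg_distrib]
    refine Finset.sum_congr rfl fun j _ => ?_
    rw [integral_mul_divergence (fun i => (hg j i).sq (hg2 j) (hh2 j i)) hV hVc (lgg j j),
      ← integral_const_mul]
    congr 1
    refine integral_congr_ae (ae_of_all _ fun x => ?_)
    simp only [Finset.mul_sum]
    exact Finset.sum_congr rfl fun i _ => by ring
  have hC : ∫ x, ∑ i, ∑ j, g i x * g j x * fderiv ℝ V x (stdVec i) j
      = - (∫ x, ∑ i, ∑ j, V x j * (g i x * h j i x))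
        - ∫ x, ∑ i, ∑ j, V x j * (h i i x * g j x) := by
    rw [integral_finsetSum _ fun i _ => integrable_finsetSum _ fun j _ => hL' i j (lgg i j),
      integral_finsetSum _ fun i _ => integrable_finsetSum _ fun j _ => hL j (lgh i j i),
      integral_finsetSum _ fun i _ => integrable_finsetSum _ fun j _ => hL j (lhg i i j),
      ← Finset.sum_neg_distrib, ← Finset.sum_sub_distrib]
    refine Finset.sum_congr rfl fun i _ => ?_
    rw [integral_finsetSum _ fun j _ => hL' i j (lgg i j),
      integral_finsetSum _ fun j _ => hL j (lgh i j i),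
      integral_finsetSum _ fun j _ => hL j (lhg i i j),
      ← Finset.sum_neg_distrib, ← Finset.sum_sub_distrib]
    refine Finset.sum_congr rfl fun j _ => ?_
    rw [((hg i i).mul (hg j i) (hg2 i) (hg2 j) (hh2 i i)
      (hh2 j i)).integral_mul_fderiv_coord hV hVc j]
    simp only [mul_add]
    rw [integral_add (hL j (lgh i j i)) (hL j (lhg i i j))]
    ring
  have hD : ∫ x, ∑ i, ∑ j, V x j * (g i x * h j i x)
      = ∫ x, ∑ j, ∑ i, V x i * (g j x * h j i x) := by
    have : ∀ᵐ x, ∀ i j, h i j x = h j i x :=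
      ae_all_iff.2 fun i => ae_all_iff.2 fun j => hsymm i j
    refine integral_congr_ae ?_
    filter_upwards [this] with x hx
    exact Finset.sum_congr rfl fun i _ => Finset.sum_congr rfl fun j _ => by rw [hx j i]
  have hE : ∫ x, (u x - ∑ i, h i i x) * ∑ j, V x j * g j x
      = (∫ x, ∑ i, V x i * (u x * g i x)) - ∫ x, ∑ i, ∑ j, V x j * (h i i x * g j x) := by
    rw [← integral_sub (integrable_finsetSum _ fun i _ => hL i (lug i))
      (integrable_finsetSum _ fun i _ => integrable_finsetSum _ fun j _ => hL j (lhg i i j))]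
    refine integral_congr_ae (ae_of_all _ fun x => ?_)
    simp only
    rw [sub_mul, Finset.mul_sum, Finset.sum_mul]
    simp only [Finset.mul_sum]
    congr 1
    · exact Finset.sum_congr rfl fun i _ => by ring
    · exact Finset.sum_congr rfl fun i _ => Finset.sum_congr rfl fun j _ => by ring
  rw [hE, hA, hB, hC, hD]
  ring

/-! ### The Riesz kernel and its regularization -/

/-- The normalizing constant of the Riesz potential. -/
noncomputable def rieszConst (N : ℕ) (α : ℝ) : ℝ :=
  Real.Gamma (((N : ℝ) - α) / 2) / (Real.pi ^ ((N : ℝ) / 2) * (2 : ℝ) ^ α * Real.Gamma (α / 2))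

theorem rieszConst_pos {α : ℝ} (hα : 0 < α) (hαN : α < N) : 0 < rieszConst N α := by
  have h1 := Real.Gamma_pos_of_pos (s := ((N : ℝ) - α) / 2) (by linarith)
  have h2 := Real.Gamma_pos_of_pos (s := α / 2) (by linarith)
  have := Real.pi_pos
  unfold rieszConst
  positivity

theorem rieszPotential_eq (α : ℝ) (z : 𝔼) :
    rieszPotential N α z = rieszConst N α * ‖z‖ ^ (α - (N : ℝ)) := by
  unfold rieszPotential rieszConst
  ring

theorem rieszPotential_nonneg {α : ℝ} (hα : 0 < α) (hαN : α < N) (z : 𝔼) :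
    0 ≤ rieszPotential N α z := by
  rw [rieszPotential_eq]
  have := rieszConst_pos hα hαN
  positivity

theorem rieszPotential_sub_comm (α : ℝ) (x y : 𝔼) :
    rieszPotential N α (x - y) = rieszPotential N α (y - x) := by
  rw [rieszPotential_eq, rieszPotential_eq, norm_sub_rev]

theorem measurable_rieszPotential (α : ℝ) : Measurable (rieszPotential N α) := by
  have : rieszPotential N α = fun z => rieszConst N α * ‖z‖ ^ (α - (N : ℝ)) :=
    funext (rieszPotential_eq α)
  rw [this]
  fun_prop

/-- The smooth kernel obtained from the Riesz potential on replacing `|z|²` by `|z|² + s`. -/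
noncomputable def regRiesz (N : ℕ) (α s : ℝ) (z : EuclideanSpace ℝ (Fin N)) : ℝ :=
  rieszConst N α * (‖z‖ ^ 2 + s) ^ ((α - (N : ℝ)) / 2)

theorem contDiff_regRiesz (α : ℝ) {s : ℝ} (hs : 0 < s) : ContDiff ℝ ∞ (regRiesz N α s) := by
  refine contDiff_const.mul (ContDiff.rpow_const_of_ne ?_ fun z => ?_)
  · exact (contDiff_norm_sq ℝ).add contDiff_const
  · positivity

theorem fderiv_regRiesz (α : ℝ) {s : ℝ} (hs : 0 < s) (z v : 𝔼) :
    fderiv ℝ (regRiesz N α s) z v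
      = (α - N) * regRiesz N α s z * (inner ℝ z v / (‖z‖ ^ 2 + s)) := by
  have hpos : 0 < ‖z‖ ^ 2 + s := by positivity
  have h1 : HasFDerivAt (fun z : 𝔼 => ‖z‖ ^ 2 + s) (2 • innerSL ℝ z) z :=
    ((hasStrictFDerivAt_norm_sq z).hasFDerivAt).add_const s
  have h2 := ((h1.rpow_const (p := (α - (N : ℝ)) / 2) (Or.inl hpos.ne')).const_mul
    (rieszConst N α)).fderiv
  unfold regRiesz
  rw [h2, Real.rpow_sub_one hpos.ne']
  simp
  ring

theorem regRiesz_pos {α : ℝ} (hα : 0 < α) (hαN : α < N) {s : ℝ} (hs : 0 < s) (z : 𝔼) :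
    0 < regRiesz N α s z := by
  have := rieszConst_pos hα hαN
  unfold regRiesz
  positivity

theorem norm_rpow_eq (z : 𝔼) (r : ℝ) : (‖z‖ ^ 2) ^ (r / 2) = ‖z‖ ^ r := by
  rw [sq_rpow_half, abs_norm]

theorem regRiesz_le {α : ℝ} (hα : 0 < α) (hαN : α < N) {s : ℝ} (hs : 0 < s) {z : 𝔼}
    (hz : z ≠ 0) : regRiesz N α s z ≤ rieszPotential N α z := by
  rw [rieszPotential_eq, regRiesz, ← norm_rpow_eq]
  have := rieszConst_pos hα hαN
  have hz' : 0 < ‖z‖ := norm_pos_iff.2 hz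
  refine mul_le_mul_of_nonneg_left (Real.rpow_le_rpow_of_nonpos (by positivity) ?_ ?_) this.le
  · linarith
  · linarith

theorem tendsto_regRiesz (α : ℝ) {z : 𝔼} (hz : z ≠ 0) {s : ℕ → ℝ}
    (hs : Tendsto s atTop (𝓝 0)) :
    Tendsto (fun n => regRiesz N α (s n) z) atTop (𝓝 (rieszPotential N α z)) := by
  rw [rieszPotential_eq, ← norm_rpow_eq]
  have hz' : 0 < ‖z‖ := norm_pos_iff.2 hz
  have h1 : Tendsto (fun n => ‖z‖ ^ 2 + s n) atTop (𝓝 (‖z‖ ^ 2)) := by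
    simpa using hs.const_add (‖z‖ ^ 2)
  exact (h1.rpow_const (Or.inl (by positivity))).const_mul _

theorem regRiesz_sub_comm (α s : ℝ) (x y : 𝔼) :
    regRiesz N α s (x - y) = regRiesz N α s (y - x) := by
  rw [regRiesz, regRiesz, norm_sub_rev]

/-- The bound `|∇K(z) · v| ≤ C I(z) |v|`, with a constant depending on the regularization. -/
theorem abs_fderiv_regRiesz_le {α : ℝ} (hα : 0 < α) (hαN : α < N) {s : ℝ} (hs : 0 < s) {z : 𝔼}
    (hz : z ≠ 0) (v : 𝔼) :
    |fderiv ℝ (regRiesz N α s) z v| ≤ (N - α) * (1 + 1 / s) * ‖v‖ * rieszPotential N α z := by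
  rw [fderiv_regRiesz α hs, abs_mul, abs_mul, abs_div,
    abs_of_nonneg (a := ‖z‖ ^ 2 + s) (by positivity), abs_of_neg (a := α - N) (by linarith),
    abs_of_pos (regRiesz_pos hα hαN hs z)]
  have h1 : |inner ℝ z v| / (‖z‖ ^ 2 + s) ≤ (1 + 1 / s) * ‖v‖ := by
    rw [div_le_iff₀ (by positivity)]
    have h2 : ‖z‖ ≤ (1 + 1 / s) * (‖z‖ ^ 2 + s) := by
      have e : (1 + 1 / s) * (‖z‖ ^ 2 + s) = ‖z‖ ^ 2 + 1 + s + 1 / s * ‖z‖ ^ 2 := by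
        field_simp; ring
      rw [e]
      have : 0 ≤ 1 / s * ‖z‖ ^ 2 := by positivity
      nlinarith [sq_nonneg (‖z‖ - 1)]
    calc |inner ℝ z v| ≤ ‖z‖ * ‖v‖ := abs_real_inner_le_norm z v
      _ ≤ ((1 + 1 / s) * (‖z‖ ^ 2 + s)) * ‖v‖ := by gcongr
      _ = _ := by ring
  calc -(α - ↑N) * regRiesz N α s z * (|inner ℝ z v| / (‖z‖ ^ 2 + s))
      ≤ (N - α) * rieszPotential N α z * ((1 + 1 / s) * ‖v‖) := by
        rw [neg_sub]
        have : 0 ≤ (N : ℝ) - α := by linarith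
        have := rieszPotential_nonneg hα hαN z
        gcongr
        exact regRiesz_le hα hαN hs hz
    _ = _ := by ring

/-- The bound `|∇K(z) · v| ≤ C I(z)` for `|v| ≤ L |z|`, uniform in the regularization. -/
theorem abs_fderiv_regRiesz_le_of_norm_le {α : ℝ} (hα : 0 < α) (hαN : α < N) {s : ℝ} (hs : 0 < s)
    {z : 𝔼} (hz : z ≠ 0) {v : 𝔼} {L : ℝ} (hv : ‖v‖ ≤ L * ‖z‖) :
    |fderiv ℝ (regRiesz N α s) z v| ≤ (N - α) * L * rieszPotential N α z := by
  have hz' : 0 < ‖z‖ := norm_pos_iff.2 hz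
  have hL : 0 ≤ L := by
    by_contra! h
    nlinarith [norm_nonneg v]
  rw [fderiv_regRiesz α hs, abs_mul, abs_mul, abs_div,
    abs_of_nonneg (a := ‖z‖ ^ 2 + s) (by positivity), abs_of_neg (a := α - N) (by linarith),
    abs_of_pos (regRiesz_pos hα hαN hs z)]
  have h1 : |inner ℝ z v| / (‖z‖ ^ 2 + s) ≤ L := by
    rw [div_le_iff₀ (by positivity)]
    calc |inner ℝ z v| ≤ ‖z‖ * ‖v‖ := abs_real_inner_le_norm z v
      _ ≤ ‖z‖ * (L * ‖z‖) := by gcongr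
      _ ≤ _ := by nlinarith
  calc -(α - ↑N) * regRiesz N α s z * (|inner ℝ z v| / (‖z‖ ^ 2 + s))
      ≤ (N - α) * rieszPotential N α z * L := by
        rw [neg_sub]
        have : 0 ≤ (N : ℝ) - α := by linarith
        have := rieszPotential_nonneg hα hαN z
        gcongr
        exact regRiesz_le hα hαN hs hz
    _ = _ := by ring

theorem fderiv_regRiesz_sub_comm (α : ℝ) {s : ℝ} (hs : 0 < s) (x y v : 𝔼) :
    fderiv ℝ (regRiesz N α s) (y - x) v = - fderiv ℝ (regRiesz N α s) (x - y) v := by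
  rw [fderiv_regRiesz α hs, fderiv_regRiesz α hs, regRiesz_sub_comm α s y x, norm_sub_rev y x,
    ← neg_sub x y, inner_neg_left]
  ring

/-! ### Double integrals against the Riesz kernel -/

/-- The convolution `I_α * a`, written as an integral. -/
noncomputable def rieszInt (α : ℝ) (a : 𝔼 → ℝ) (x : 𝔼) : ℝ :=
  ∫ y, rieszPotential N α (x - y) * a y

theorem rieszInt_nonneg {α : ℝ} (hα : 0 < α) (hαN : α < N) {a : 𝔼 → ℝ} (ha0 : ∀ y, 0 ≤ a y)
    (x : 𝔼) : 0 ≤ rieszInt α a x :=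
  integral_nonneg fun y => mul_nonneg (rieszPotential_nonneg hα hαN (x - y)) (ha0 y)

theorem aestronglyMeasurable_rieszPotential_sub (α : ℝ) :
    AEStronglyMeasurable (fun z : 𝔼 × 𝔼 => rieszPotential N α (z.1 - z.2))
      (volume.prod volume) :=
  ((measurable_rieszPotential α).comp (measurable_fst.sub measurable_snd)).aestronglyMeasurable

/-- The diagonal is negligible. It has to be avoided in comparisons with the Riesz potential, whose
value at the origin is `0` by the convention for negative powers of `0`. -/
theorem ae_prod_ne (hN : 0 < N) : ∀ᵐ z : 𝔼 × 𝔼 ∂(volume.prod volume), z.1 - z.2 ≠ 0 := by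
  have : Nonempty (Fin N) := ⟨⟨0, hN⟩⟩
  have hm : MeasurableSet {z : 𝔼 × 𝔼 | z.1 - z.2 ≠ 0} :=
    (measurable_fst.sub measurable_snd) (measurableSet_singleton 0).compl
  refine (Measure.ae_prod_iff_ae_ae hm).2 (ae_of_all _ fun x => ?_)
  filter_upwards [compl_mem_ae_iff.2 (measure_singleton x)] with y hy h
  exact hy (sub_eq_zero.1 h).symm

/-- Tonelli's theorem for the double integral `∬ I(x - y) a(y) w(x)`. -/
theorem integrable_rieszPotential_mul {α : ℝ} (hα : 0 < α) (hαN : α < N) {a w : 𝔼 → ℝ}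
    (ha0 : ∀ y, 0 ≤ a y) (ham : AEStronglyMeasurable a)
    (ha : ∀ᵐ x, Integrable (fun y => rieszPotential N α (x - y) * a y))
    (hwm : AEStronglyMeasurable w) (hw : Integrable (fun x => rieszInt α a x * w x)) :
    Integrable (fun z : 𝔼 × 𝔼 => rieszPotential N α (z.1 - z.2) * a z.2 * w z.1)
      (volume.prod volume) := by
  have hm : AEStronglyMeasurable
      (fun z : 𝔼 × 𝔼 => rieszPotential N α (z.1 - z.2) * a z.2 * w z.1) (volume.prod volume) :=
    ((aestronglyMeasurable_rieszPotential_sub α).mul ham.comp_snd).mul hwm.comp_fst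
  rw [integrable_prod_iff hm]
  refine ⟨?_, ?_⟩
  · filter_upwards [ha] with x hx
    exact hx.mul_const _
  · refine hw.norm.congr (ae_of_all _ fun x => ?_)
    have h1 : ∀ y, ‖rieszPotential N α (x - y) * a y * w x‖
        = rieszPotential N α (x - y) * a y * ‖w x‖ := fun y => by
      rw [norm_mul, Real.norm_eq_abs, abs_of_nonneg
        (mul_nonneg (rieszPotential_nonneg hα hαN _) (ha0 y))]
    simp only [h1]
    rw [integral_mul_const, norm_mul, Real.norm_eq_abs (rieszInt α a x),
      abs_of_nonneg (rieszInt_nonneg hα hαN ha0 x)]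
    rfl

theorem integral_rieszPotential_mul {α : ℝ} {a w : 𝔼 → ℝ}
    (h : Integrable (fun z : 𝔼 × 𝔼 => rieszPotential N α (z.1 - z.2) * a z.2 * w z.1)
      (volume.prod volume)) :
    ∫ z : 𝔼 × 𝔼, rieszPotential N α (z.1 - z.2) * a z.2 * w z.1 ∂(volume.prod volume)
      = ∫ x, rieszInt α a x * w x := by
  rw [integral_prod _ h]
  refine integral_congr_ae (ae_of_all _ fun x => ?_)
  simp only
  rw [integral_mul_const]
  rfl

theorem integrable_regRiesz_mul {α : ℝ} (hα : 0 < α) (hαN : α < N) {s : ℝ} (hs : 0 < s)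
    {F : 𝔼 × 𝔼 → ℝ} (hF : AEStronglyMeasurable F (volume.prod volume))
    (h : Integrable (fun z : 𝔼 × 𝔼 => rieszPotential N α (z.1 - z.2) * F z)
      (volume.prod volume)) :
    Integrable (fun z : 𝔼 × 𝔼 => regRiesz N α s (z.1 - z.2) * F z) (volume.prod volume) := by
  have hN : 0 < N := by exact_mod_cast hα.trans hαN
  refine h.norm.mono' ?_ ?_
  · exact ((contDiff_regRiesz α hs).continuous.comp
      (continuous_fst.sub continuous_snd)).aestronglyMeasurable.mul hF
  · filter_upwards [ae_prod_ne hN] with z hz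
    rw [norm_mul, norm_mul, Real.norm_eq_abs, Real.norm_eq_abs (rieszPotential N α _),
      abs_of_pos (regRiesz_pos hα hαN hs _), abs_of_nonneg (rieszPotential_nonneg hα hαN _)]
    gcongr
    exact regRiesz_le hα hαN hs hz

theorem divergence_smul {k : 𝔼 → ℝ} {V : 𝔼 → 𝔼} {x : 𝔼} (hk : DifferentiableAt ℝ k x)
    (hV : DifferentiableAt ℝ V x) :
    divergence (fun x => k x • V x) x = k x * divergence V x + fderiv ℝ k x (V x) := by
  have h1 : V x = ∑ i, V x i • stdVec i := by
    ext j
    simp [Finset.sum_apply, Pi.single_apply]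
  have h2 : fderiv ℝ k x (V x) = ∑ i, V x i * fderiv ℝ k x (stdVec i) := by
    conv_lhs => rw [h1, map_sum]
    simp
  rw [h2, divergence, divergence, fderiv_fun_smul hk hV, Finset.mul_sum, ← Finset.sum_add_distrib]
  refine Finset.sum_congr rfl fun i _ => ?_
  simp
  ring

theorem integral_mul_field_of_smul {b : 𝔼 → ℝ} {w : Fin N → 𝔼 → ℝ} (hbl : LocallyIntegrable b)
    (hb : ∀ i, HasWeakDeriv (stdVec i) b (w i)) {k : 𝔼 → ℝ} (hk : ContDiff ℝ ∞ k)
    {V : 𝔼 → 𝔼} (hV : ContDiff ℝ ∞ V) (hVc : HasCompactSupport V) :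
    ∫ x, k x * ∑ i, V x i * w i x
      = - ∫ x, b x * (k x * divergence V x + fderiv ℝ k x (V x)) := by
  have hX : ContDiff ℝ ∞ (fun x => k x • V x) := hk.smul hV
  have hXc : HasCompactSupport (fun x => k x • V x) :=
    hVc.mono fun x hx h0 => hx (by simp only [h0, smul_zero])
  have key := integral_mul_divergence hb hX hXc hbl
  have e : ∀ x, divergence (fun x => k x • V x) x = k x * divergence V x + fderiv ℝ k x (V x) :=
    fun x => divergence_smul (hk.differentiable (by simp) x) (hV.differentiable (by simp) x)
  simp only [e] at key
  rw [key, neg_neg]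
  refine integral_congr_ae (ae_of_all _ fun x => ?_)
  simp only [PiLp.smul_apply, smul_eq_mul, mul_assoc, Finset.mul_sum]

/-- Integration by parts in one variable of a double integral against the regularized kernel. -/
theorem integral_regRiesz_mul_field {α : ℝ} (hα : 0 < α) (hαN : α < N) {s : ℝ} (hs : 0 < s)
    {a b : 𝔼 → ℝ} {w : Fin N → 𝔼 → ℝ} (ham : AEStronglyMeasurable a)
    (hbl : LocallyIntegrable b) (hb : ∀ i, HasWeakDeriv (stdVec i) b (w i))
    (hab : Integrable (fun z : 𝔼 × 𝔼 => rieszPotential N α (z.1 - z.2) * a z.2 * b z.1)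
      (volume.prod volume))
    {V : 𝔼 → 𝔼} (hV : ContDiff ℝ ∞ V) (hVc : HasCompactSupport V)
    (hw : Integrable (fun z : 𝔼 × 𝔼 => rieszPotential N α (z.1 - z.2) * a z.2 *
      ∑ i, V z.1 i * w i z.1) (volume.prod volume)) :
    Integrable (fun z : 𝔼 × 𝔼 => a z.2 * b z.1 * (regRiesz N α s (z.1 - z.2) * divergence V z.1
        + fderiv ℝ (regRiesz N α s) (z.1 - z.2) (V z.1))) (volume.prod volume) ∧
    ∫ z : 𝔼 × 𝔼, regRiesz N α s (z.1 - z.2) * (a z.2 * ∑ i, V z.1 i * w i z.1)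
        ∂(volume.prod volume)
      = - ∫ z : 𝔼 × 𝔼, a z.2 * b z.1 * (regRiesz N α s (z.1 - z.2) * divergence V z.1
        + fderiv ℝ (regRiesz N α s) (z.1 - z.2) (V z.1)) ∂(volume.prod volume) := by
  have hN : 0 < N := by exact_mod_cast hα.trans hαN
  have hKs := contDiff_regRiesz (N := N) α hs
  have hdivc := continuous_divergence hV
  have hbm := hbl.aestronglyMeasurable
  have hwm : AEStronglyMeasurable (fun x => ∑ i, V x i * w i x) :=
    Finset.aestronglyMeasurable_fun_sum _ fun i _ =>
      (contDiff_coord hV i).continuous.aestronglyMeasurable.mul (hb i).2.1.aestronglyMeasurable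
  obtain ⟨C, hC⟩ := hdivc.bounded_above_of_compact_support (hasCompactSupport_divergence hVc)
  obtain ⟨M, hM⟩ := hV.continuous.bounded_above_of_compact_support hVc
  have hint2 : Integrable (fun z : 𝔼 × 𝔼 => a z.2 * b z.1 *
      (regRiesz N α s (z.1 - z.2) * divergence V z.1
        + fderiv ℝ (regRiesz N α s) (z.1 - z.2) (V z.1))) (volume.prod volume) := by
    refine (hab.norm.const_mul (C + (N - α) * (1 + 1 / s) * M)).mono' ?_ ?_
    · refine (ham.comp_snd.mul hbm.comp_fst).mul (Continuous.aestronglyMeasurable ?_)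
      refine ((hKs.continuous.comp (continuous_fst.sub continuous_snd)).mul
        (hdivc.comp continuous_fst)).add ?_
      exact ((hKs.continuous_fderiv (by simp)).comp (continuous_fst.sub continuous_snd)).clm_apply
        (hV.continuous.comp continuous_fst)
    · filter_upwards [ae_prod_ne hN] with z hz
      have hI := rieszPotential_nonneg hα hαN (z.1 - z.2)
      have hNα : 0 ≤ (N : ℝ) - α := by linarith
      have h1 : |regRiesz N α s (z.1 - z.2) * divergence V z.1
          + fderiv ℝ (regRiesz N α s) (z.1 - z.2) (V z.1)|
          ≤ (C + (N - α) * (1 + 1 / s) * M) * rieszPotential N α (z.1 - z.2) := by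
        refine (abs_add_le _ _).trans ?_
        rw [add_mul, abs_mul, abs_of_pos (regRiesz_pos hα hαN hs _)]
        refine add_le_add ?_ ?_
        · rw [mul_comm C]
          exact mul_le_mul (regRiesz_le hα hαN hs hz) (hC _) (abs_nonneg _) hI
        · refine (abs_fderiv_regRiesz_le hα hαN hs hz _).trans ?_
          gcongr
          exact hM _
      rw [norm_mul, norm_mul, norm_mul, norm_mul, Real.norm_eq_abs (rieszPotential _ _ _),
        abs_of_nonneg hI]
      calc ‖a z.2‖ * ‖b z.1‖ * ‖_‖ ≤ ‖a z.2‖ * ‖b z.1‖ *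
            ((C + (N - α) * (1 + 1 / s) * M) * rieszPotential N α (z.1 - z.2)) := by
            gcongr
            exact h1
        _ = _ := by ring
  refine ⟨hint2, ?_⟩
  have hint1 : Integrable (fun z : 𝔼 × 𝔼 =>
      regRiesz N α s (z.1 - z.2) * (a z.2 * ∑ i, V z.1 i * w i z.1)) (volume.prod volume) :=
    integrable_regRiesz_mul hα hαN hs (ham.comp_snd.mul hwm.comp_fst)
      (by simpa only [mul_assoc] using hw)
  rw [integral_prod_symm _ hint1, integral_prod_symm _ hint2, ← integral_neg]
  refine integral_congr_ae (ae_of_all _ fun y => ?_)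
  beta_reduce
  have hk : ContDiff ℝ ∞ (fun x : 𝔼 => regRiesz N α s (x - y)) :=
    hKs.comp (contDiff_id.sub contDiff_const)
  have hfk : ∀ x, fderiv ℝ (fun x : 𝔼 => regRiesz N α s (x - y)) x
      = fderiv ℝ (regRiesz N α s) (x - y) := fun x => by
    have := (((hKs.differentiable (by simp)).differentiableAt (x := x - y)).hasFDerivAt.comp x
      ((hasFDerivAt_id x).sub_const y)).fderiv
    rwa [ContinuousLinearMap.comp_id] at this
  have key := integral_mul_field_of_smul hbl hb hk hV hVc
  simp only [hfk] at key
  calc ∫ x, regRiesz N α s (x - y) * (a y * ∑ i, V x i * w i x)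
      = a y * ∫ x, regRiesz N α s (x - y) * ∑ i, V x i * w i x := by
        rw [← integral_const_mul]
        refine integral_congr_ae (ae_of_all _ fun x => ?_)
        ring
    _ = -∫ x, a y * (b x * (regRiesz N α s (x - y) * divergence V x
          + fderiv ℝ (regRiesz N α s) (x - y) (V x))) := by
        rw [key, mul_neg, integral_const_mul]
    _ = _ := by simp only [mul_assoc]

/-! ### The nonlinear term tested against a vector field -/

theorem tendsto_integral_regRiesz_mul {α : ℝ} (hα : 0 < α) (hαN : α < N) {s : ℕ → ℝ}
    (hs0 : ∀ n, 0 < s n) (hs : Tendsto s atTop (𝓝 0))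
    {F : 𝔼 × 𝔼 → ℝ} (hF : AEStronglyMeasurable F (volume.prod volume))
    (h : Integrable (fun z : 𝔼 × 𝔼 => rieszPotential N α (z.1 - z.2) * F z)
      (volume.prod volume)) :
    Tendsto (fun n => ∫ z : 𝔼 × 𝔼, regRiesz N α (s n) (z.1 - z.2) * F z ∂(volume.prod volume))
      atTop (𝓝 (∫ z : 𝔼 × 𝔼, rieszPotential N α (z.1 - z.2) * F z ∂(volume.prod volume))) := by
  have hN : 0 < N := by exact_mod_cast hα.trans hαN
  refine tendsto_integral_of_dominated_convergence
    (fun z => ‖rieszPotential N α (z.1 - z.2) * F z‖) (fun n => ?_) h.norm (fun n => ?_) ?_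
  · exact (integrable_regRiesz_mul hα hαN (hs0 n) hF h).aestronglyMeasurable
  · filter_upwards [ae_prod_ne hN] with z hz
    rw [norm_mul, norm_mul, Real.norm_eq_abs, Real.norm_eq_abs (rieszPotential N α _),
      abs_of_pos (regRiesz_pos hα hαN (hs0 n) _), abs_of_nonneg (rieszPotential_nonneg hα hαN _)]
    gcongr
    exact regRiesz_le hα hαN (hs0 n) hz
  · filter_upwards [ae_prod_ne hN] with z hz
    exact (tendsto_regRiesz α hz hs).mul_const _

/-- The kernel `div V(x) + div V(y) + (α - N) ⟨x - y, V(x) - V(y)⟩ / |x - y|²` that arises on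
differentiating the Riesz energy along the flow of `V`. -/
noncomputable def variationKernel (α : ℝ) (V : 𝔼 → 𝔼) (z : 𝔼 × 𝔼) : ℝ :=
  divergence V z.1 + divergence V z.2
    + (α - N) * (inner ℝ (z.1 - z.2) (V z.1 - V z.2) / ‖z.1 - z.2‖ ^ 2)

theorem abs_variationKernel_le {α : ℝ} (hαN : α < N) {V : 𝔼 → 𝔼} {L C : ℝ} (hL0 : 0 ≤ L)
    (hL : ∀ x y, ‖V x - V y‖ ≤ L * ‖x - y‖) (hC : ∀ x, |divergence V x| ≤ C) (z : 𝔼 × 𝔼) :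
    |variationKernel α V z| ≤ 2 * C + (N - α) * L := by
  have hq : |inner ℝ (z.1 - z.2) (V z.1 - V z.2) / ‖z.1 - z.2‖ ^ 2| ≤ L := by
    rw [abs_div, abs_of_nonneg (a := ‖z.1 - z.2‖ ^ 2) (by positivity)]
    refine div_le_of_le_mul₀ (by positivity) hL0 ?_
    calc _ ≤ ‖z.1 - z.2‖ * ‖V z.1 - V z.2‖ := abs_real_inner_le_norm _ _
      _ ≤ ‖z.1 - z.2‖ * (L * ‖z.1 - z.2‖) := by gcongr; exact hL _ _
      _ = _ := by ring
  have h1 := abs_add_three (divergence V z.1) (divergence V z.2)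
    ((α - N) * (inner ℝ (z.1 - z.2) (V z.1 - V z.2) / ‖z.1 - z.2‖ ^ 2))
  rw [abs_mul (α - N), abs_of_neg (a := α - N) (by linarith)] at h1
  have h2 : -(α - N) * |inner ℝ (z.1 - z.2) (V z.1 - V z.2) / ‖z.1 - z.2‖ ^ 2|
      ≤ (N - α) * L := by
    rw [neg_sub]
    exact mul_le_mul_of_nonneg_left hq (by linarith)
  unfold variationKernel
  linarith [hC z.1, hC z.2]

/-- Integration by parts in both variables of the Riesz energy. The gradient of the kernel is only
met through `∇I(x - y) · (V(x) - V(y))`, which is of the order of `I(x - y)`. -/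
theorem integral_rieszInt_mul_field {α : ℝ} (hα : 0 < α) (hαN : α < N) {a b : 𝔼 → ℝ}
    {wa wb : Fin N → 𝔼 → ℝ} (hal : LocallyIntegrable a) (hbl : LocallyIntegrable b)
    (ha : ∀ i, HasWeakDeriv (stdVec i) a (wa i)) (hb : ∀ i, HasWeakDeriv (stdVec i) b (wb i))
    (hab : Integrable (fun z : 𝔼 × 𝔼 => rieszPotential N α (z.1 - z.2) * a z.2 * b z.1)
      (volume.prod volume))
    {V : 𝔼 → 𝔼} (hV : ContDiff ℝ ∞ V) (hVc : HasCompactSupport V) {L C : ℝ}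
    (hL : ∀ x y, ‖V x - V y‖ ≤ L * ‖x - y‖) (hC : ∀ x, |divergence V x| ≤ C)
    (hwb : Integrable (fun z : 𝔼 × 𝔼 => rieszPotential N α (z.1 - z.2) * a z.2 *
      ∑ i, V z.1 i * wb i z.1) (volume.prod volume))
    (hwa : Integrable (fun z : 𝔼 × 𝔼 => rieszPotential N α (z.1 - z.2) * b z.2 *
      ∑ i, V z.1 i * wa i z.1) (volume.prod volume)) :
    (∫ x, rieszInt α a x * ∑ i, V x i * wb i x) + (∫ x, rieszInt α b x * ∑ i, V x i * wa i x)
      = - ∫ z : 𝔼 × 𝔼, rieszPotential N α (z.1 - z.2) * a z.2 * b z.1 * variationKernel α V z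
          ∂(volume.prod volume) := by
  have hN : 0 < N := by exact_mod_cast hα.trans hαN
  have hNα : 0 ≤ (N : ℝ) - α := by linarith
  set s : ℕ → ℝ := fun n => 1 / ((n : ℝ) + 1) with hsdef
  have hs0 : ∀ n, 0 < s n := fun n => by positivity
  have hs : Tendsto s atTop (𝓝 0) := tendsto_one_div_add_atTop_nhds_zero_nat
  have ham := hal.aestronglyMeasurable
  have hbm := hbl.aestronglyMeasurable
  have hWm : ∀ {c : 𝔼 → ℝ} {w : Fin N → 𝔼 → ℝ}, (∀ i, HasWeakDeriv (stdVec i) c (w i)) →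
      AEStronglyMeasurable (fun x => ∑ i, V x i * w i x) := fun hc =>
    Finset.aestronglyMeasurable_fun_sum _ fun i _ =>
      (contDiff_coord hV i).continuous.aestronglyMeasurable.mul (hc i).2.1.aestronglyMeasurable
  have hba : Integrable (fun z : 𝔼 × 𝔼 => rieszPotential N α (z.1 - z.2) * b z.2 * a z.1)
      (volume.prod volume) := by
    refine hab.swap.congr (ae_of_all _ fun z => ?_)
    simp only [Function.comp_apply, Prod.fst_swap, Prod.snd_swap]
    rw [rieszPotential_sub_comm]; ring
  have E1 := fun n => integral_regRiesz_mul_field hα hαN (hs0 n) ham hbl hb hab hV hVc hwb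
  have E2 := fun n => integral_regRiesz_mul_field hα hαN (hs0 n) hbm hal ha hba hV hVc hwa
  have l1 := tendsto_integral_regRiesz_mul hα hαN hs0 hs
    (F := fun z => a z.2 * ∑ i, V z.1 i * wb i z.1) (ham.comp_snd.mul (hWm hb).comp_fst)
    (by simpa only [mul_assoc] using hwb)
  have l2 := tendsto_integral_regRiesz_mul hα hαN hs0 hs
    (F := fun z => b z.2 * ∑ i, V z.1 i * wa i z.1) (hbm.comp_snd.mul (hWm ha).comp_fst)
    (by simpa only [mul_assoc] using hwa)
  have r1 := integral_rieszPotential_mul (w := fun x => ∑ i, V x i * wb i x) hwb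
  have r2 := integral_rieszPotential_mul (w := fun x => ∑ i, V x i * wa i x) hwa
  simp only [mul_assoc] at r1 r2
  rw [r1] at l1
  rw [r2] at l2
  -- the second double integral, with the two variables exchanged
  have E2' : ∀ n, Integrable (fun z : 𝔼 × 𝔼 => a z.2 * b z.1 *
        (regRiesz N α (s n) (z.1 - z.2) * divergence V z.2
          - fderiv ℝ (regRiesz N α (s n)) (z.1 - z.2) (V z.2))) (volume.prod volume) ∧
      ∫ z : 𝔼 × 𝔼, regRiesz N α (s n) (z.1 - z.2) * (b z.2 * ∑ i, V z.1 i * wa i z.1)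
        ∂(volume.prod volume)
      = - ∫ z : 𝔼 × 𝔼, a z.2 * b z.1 * (regRiesz N α (s n) (z.1 - z.2) * divergence V z.2
        - fderiv ℝ (regRiesz N α (s n)) (z.1 - z.2) (V z.2)) ∂(volume.prod volume) := fun n => by
    obtain ⟨hi, he⟩ := E2 n
    have hsw : ∀ z : 𝔼 × 𝔼, (fun z : 𝔼 × 𝔼 => b z.2 * a z.1 *
        (regRiesz N α (s n) (z.1 - z.2) * divergence V z.1
          + fderiv ℝ (regRiesz N α (s n)) (z.1 - z.2) (V z.1))) z.swap
        = a z.2 * b z.1 * (regRiesz N α (s n) (z.1 - z.2) * divergence V z.2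
          - fderiv ℝ (regRiesz N α (s n)) (z.1 - z.2) (V z.2)) := fun z => by
      simp only [Prod.fst_swap, Prod.snd_swap]
      rw [regRiesz_sub_comm, fderiv_regRiesz_sub_comm α (hs0 n)]
      ring
    refine ⟨hi.swap.congr (ae_of_all _ hsw), ?_⟩
    rw [he, ← integral_prod_swap]
    simp only [hsw]
  have hsum : ∀ n, (∫ z : 𝔼 × 𝔼, regRiesz N α (s n) (z.1 - z.2) * (a z.2 *
        ∑ i, V z.1 i * wb i z.1) ∂(volume.prod volume))
      + (∫ z : 𝔼 × 𝔼, regRiesz N α (s n) (z.1 - z.2) * (b z.2 * ∑ i, V z.1 i * wa i z.1)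
        ∂(volume.prod volume))
      = - ∫ z : 𝔼 × 𝔼, a z.2 * b z.1 * (regRiesz N α (s n) (z.1 - z.2) *
          (divergence V z.1 + divergence V z.2)
        + fderiv ℝ (regRiesz N α (s n)) (z.1 - z.2) (V z.1 - V z.2)) ∂(volume.prod volume) :=
    fun n => by
    rw [(E1 n).2, (E2' n).2, ← neg_add, ← integral_add (E1 n).1 (E2' n).1]
    congr 1
    refine integral_congr_ae (ae_of_all _ fun z => ?_)
    simp only [map_sub]
    ring
  have l3 : Tendsto (fun n => ∫ z : 𝔼 × 𝔼, a z.2 * b z.1 * (regRiesz N α (s n) (z.1 - z.2) *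
          (divergence V z.1 + divergence V z.2)
        + fderiv ℝ (regRiesz N α (s n)) (z.1 - z.2) (V z.1 - V z.2)) ∂(volume.prod volume)) atTop
      (𝓝 (∫ z : 𝔼 × 𝔼, rieszPotential N α (z.1 - z.2) * a z.2 * b z.1 * variationKernel α V z
          ∂(volume.prod volume))) := by
    refine tendsto_integral_of_dominated_convergence
      (fun z => (2 * C + (N - α) * L) * ‖rieszPotential N α (z.1 - z.2) * a z.2 * b z.1‖)
      (fun n => ?_) (hab.norm.const_mul _) (fun n => ?_) ?_
    · refine ((E1 n).1.add (E2' n).1).aestronglyMeasurable.congr (ae_of_all _ fun z => ?_)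
      simp only [map_sub, Pi.add_apply]
      ring
    · filter_upwards [ae_prod_ne hN] with z hz
      have hI := rieszPotential_nonneg hα hαN (z.1 - z.2)
      have hK := regRiesz_pos hα hαN (hs0 n) (z.1 - z.2)
      have hKI := regRiesz_le hα hαN (hs0 n) hz
      have h1 : |regRiesz N α (s n) (z.1 - z.2) * (divergence V z.1 + divergence V z.2)
          + fderiv ℝ (regRiesz N α (s n)) (z.1 - z.2) (V z.1 - V z.2)|
          ≤ (2 * C + (N - α) * L) * rieszPotential N α (z.1 - z.2) := by
        refine (abs_add_le _ _).trans ?_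
        rw [add_mul, abs_mul, abs_of_pos hK]
        refine add_le_add ?_ (abs_fderiv_regRiesz_le_of_norm_le hα hαN (hs0 n) hz (hL _ _))
        rw [mul_comm (2 * C)]
        refine mul_le_mul hKI ?_ (abs_nonneg _) hI
        linarith [abs_add_le (divergence V z.1) (divergence V z.2), hC z.1, hC z.2]
      rw [norm_mul, norm_mul, norm_mul, norm_mul, Real.norm_eq_abs (rieszPotential _ _ _),
        abs_of_nonneg hI]
      calc ‖a z.2‖ * ‖b z.1‖ * ‖_‖ ≤ ‖a z.2‖ * ‖b z.1‖ *
            ((2 * C + (N - α) * L) * rieszPotential N α (z.1 - z.2)) := by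
            gcongr
            exact h1
        _ = _ := by ring
    · filter_upwards [ae_prod_ne hN] with z hz
      have hz' : 0 < ‖z.1 - z.2‖ := norm_pos_iff.2 hz
      have hK := tendsto_regRiesz α hz hs
      simp only [fun n => fderiv_regRiesz α (hs0 n) (z.1 - z.2) (V z.1 - V z.2)]
      have hd : Tendsto (fun n => ‖z.1 - z.2‖ ^ 2 + s n) atTop (𝓝 (‖z.1 - z.2‖ ^ 2)) := by
        simpa using hs.const_add (‖z.1 - z.2‖ ^ 2)
      have hlim := ((hK.mul_const (divergence V z.1 + divergence V z.2)).add
        ((hK.const_mul (α - (N : ℝ))).mul ((tendsto_const_nhds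
          (x := inner ℝ (z.1 - z.2) (V z.1 - V z.2))).div hd (by positivity)))).const_mul
            (a z.2 * b z.1)
      have e : rieszPotential N α (z.1 - z.2) * a z.2 * b z.1 * variationKernel α V z
          = a z.2 * b z.1 * (rieszPotential N α (z.1 - z.2) *
            (divergence V z.1 + divergence V z.2) + (α - N) * rieszPotential N α (z.1 - z.2) *
            (inner ℝ (z.1 - z.2) (V z.1 - V z.2) / ‖z.1 - z.2‖ ^ 2)) := by
        unfold variationKernel
        ring
      rw [e]
      exact hlim
  exact tendsto_nhds_unique ((l1.add l2).congr hsum) l3.neg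

/-! ### Truncated dilations -/

/-- A cutoff function on `ℝ^N`, equal to `1` on the unit ball. -/
noncomputable def unitCutoff (N : ℕ) : ContDiffBump (0 : EuclideanSpace ℝ (Fin N)) where
  rIn := 1
  rOut := 2
  rIn_pos := one_pos
  rIn_lt_rOut := one_lt_two

/-- The cutoff at scale `n + 1`. -/
noncomputable def cutoff (N n : ℕ) (x : EuclideanSpace ℝ (Fin N)) : ℝ :=
  unitCutoff N (((n : ℝ) + 1)⁻¹ • x)

/-- The dilation field `x ↦ x` cut off at scale `n + 1`. -/
noncomputable def dilationField (n : ℕ) (x : 𝔼) : 𝔼 := cutoff N n x • x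

theorem contDiff_cutoff (n : ℕ) : ContDiff ℝ ∞ (cutoff N n) :=
  (unitCutoff N).contDiff.comp (contDiff_const_smul _)

theorem hasCompactSupport_cutoff (n : ℕ) : HasCompactSupport (cutoff N n) :=
  (unitCutoff N).hasCompactSupport.comp_homeomorph
    (Homeomorph.smulOfNeZero ((n : ℝ) + 1)⁻¹ (by positivity))

theorem cutoff_nonneg (n : ℕ) (x : 𝔼) : 0 ≤ cutoff N n x := (unitCutoff N).nonneg

theorem cutoff_le_one (n : ℕ) (x : 𝔼) : cutoff N n x ≤ 1 := (unitCutoff N).le_one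

theorem cutoff_eq_one {n : ℕ} {x : 𝔼} (hx : ‖x‖ ≤ n + 1) : cutoff N n x = 1 := by
  refine (unitCutoff N).one_of_mem_closedBall ?_
  rw [mem_closedBall, dist_zero_right, norm_smul, norm_inv, Real.norm_eq_abs,
    abs_of_pos (by positivity), inv_mul_le_iff₀ (by positivity)]
  simpa [unitCutoff] using hx

theorem fderiv_comp_inv_smul {F : Type*} [NormedAddCommGroup F] [NormedSpace ℝ F] {f : 𝔼 → F}
    (hf : Differentiable ℝ f) (c : ℝ) (x : 𝔼) :
    fderiv ℝ (fun x => f (c • x)) x = c • fderiv ℝ f (c • x) := by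
  have := ((hf (c • x)).hasFDerivAt.comp x ((hasFDerivAt_id x).const_smul c)).fderiv
  change fderiv ℝ (fun x => f (c • x)) x = _ at this
  rw [this]
  ext v
  simp

theorem fderiv_smul_comp_inv_smul {F : Type*} [NormedAddCommGroup F] [NormedSpace ℝ F] {f : 𝔼 → F}
    (hf : Differentiable ℝ f) {c : ℝ} (hc : c ≠ 0) (x : 𝔼) :
    fderiv ℝ (fun x => c • f (c⁻¹ • x)) x = fderiv ℝ f (c⁻¹ • x) := by
  have hd : DifferentiableAt ℝ (fun x => f (c⁻¹ • x)) x :=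
    (hf _).comp x (differentiableAt_id.const_smul c⁻¹)
  rw [fderiv_fun_const_smul hd, fderiv_comp_inv_smul hf, smul_smul, mul_inv_cancel₀ hc, one_smul]

theorem exists_fderiv_cutoff_le (N : ℕ) :
    ∃ C, ∀ n (x : EuclideanSpace ℝ (Fin N)), ‖fderiv ℝ (cutoff N n) x‖ ≤ C := by
  obtain ⟨C, hC⟩ := ((unitCutoff N).contDiff (n := 1).continuous_fderiv
    (by simp)).bounded_above_of_compact_support ((unitCutoff N).hasCompactSupport.fderiv ℝ)
  refine ⟨C, fun n x => ?_⟩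
  have hn : (1 : ℝ) ≤ n + 1 := by linarith [(n.cast_nonneg : (0 : ℝ) ≤ n)]
  unfold cutoff
  rw [fderiv_comp_inv_smul ((unitCutoff N).contDiff (n := 1).differentiable (by simp)),
    norm_smul, norm_inv, Real.norm_eq_abs, abs_of_pos (by positivity)]
  calc _ ≤ 1 * C := mul_le_mul (inv_le_one_of_one_le₀ hn) (hC _) (norm_nonneg _) zero_le_one
    _ = C := one_mul C

theorem contDiff_dilationField (n : ℕ) : ContDiff ℝ ∞ (dilationField (N := N) n) :=
  (contDiff_cutoff n).smul contDiff_id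

theorem hasCompactSupport_dilationField (n : ℕ) : HasCompactSupport (dilationField (N := N) n) :=
  (hasCompactSupport_cutoff n).mono fun x hx h0 => hx (by simp only [dilationField, h0, zero_smul])

/-- The derivatives of the truncated dilations are bounded uniformly in the scale, since all of them
are rescalings of one field. -/
theorem exists_fderiv_dilationField_le (N : ℕ) :
    ∃ L, ∀ n (x : EuclideanSpace ℝ (Fin N)), ‖fderiv ℝ (dilationField n) x‖ ≤ L := by
  set W : EuclideanSpace ℝ (Fin N) → EuclideanSpace ℝ (Fin N) := fun x => unitCutoff N x • x
    with hW
  have hWd : ContDiff ℝ 1 W := (unitCutoff N).contDiff.smul contDiff_id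
  have hWc : HasCompactSupport W := (unitCutoff N).hasCompactSupport.mono fun x hx h0 =>
    hx (by simp only [hW, h0, zero_smul])
  obtain ⟨L, hL⟩ := (hWd.continuous_fderiv (by simp)).bounded_above_of_compact_support
    (hWc.fderiv ℝ)
  refine ⟨L, fun n x => ?_⟩
  have hn : (n : ℝ) + 1 ≠ 0 := by positivity
  have e : dilationField (N := N) n = fun x => ((n : ℝ) + 1) • W (((n : ℝ) + 1)⁻¹ • x) := by
    ext1 x
    simp only [dilationField, cutoff, hW, smul_smul]
    congr 1
    field_simp
  rw [e, fderiv_smul_comp_inv_smul (hWd.differentiable (by simp)) hn]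
  exact hL _

theorem fderiv_dilationField_eq {n : ℕ} {x : 𝔼} (hx : ‖x‖ < n + 1) :
    fderiv ℝ (dilationField (N := N) n) x = ContinuousLinearMap.id ℝ 𝔼 := by
  have h : dilationField (N := N) n =ᶠ[𝓝 x] id := by
    filter_upwards [(isOpen_lt continuous_norm continuous_const).mem_nhds hx] with y hy
    simp [dilationField, cutoff_eq_one (le_of_lt hy)]
  rw [h.fderiv_eq, fderiv_id]

theorem dilationField_eq {n : ℕ} {x : 𝔼} (hx : ‖x‖ < n + 1) : dilationField (N := N) n x = x := by
  rw [dilationField, cutoff_eq_one hx.le, one_smul]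

theorem eventually_norm_lt (x : 𝔼) : ∀ᶠ n : ℕ in atTop, ‖x‖ < (n : ℝ) + 1 := by
  filter_upwards [eventually_ge_atTop ⌈‖x‖⌉₊] with n hn
  have := (Nat.le_ceil ‖x‖).trans (Nat.cast_le.2 hn)
  linarith

theorem divergence_dilationField_eq {n : ℕ} {x : 𝔼} (hx : ‖x‖ < n + 1) :
    divergence (dilationField (N := N) n) x = N := by
  simp [divergence, fderiv_dilationField_eq hx]

theorem abs_fderiv_coord_le {V : 𝔼 → 𝔼} {L : ℝ} {x : 𝔼} (hL : ‖fderiv ℝ V x‖ ≤ L)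
    (i j : Fin N) : |fderiv ℝ V x (stdVec i) j| ≤ L := by
  refine (PiLp.norm_apply_le (fderiv ℝ V x (stdVec i)) j).trans ?_
  refine ((fderiv ℝ V x).le_opNorm _).trans ?_
  simpa using hL

theorem abs_divergence_le {V : 𝔼 → 𝔼} {L : ℝ} {x : 𝔼} (hL : ‖fderiv ℝ V x‖ ≤ L) :
    |divergence V x| ≤ N * L := by
  refine (Finset.abs_sum_le_sum_abs _ _).trans ?_
  refine (Finset.sum_le_sum fun i _ => abs_fderiv_coord_le hL i i).trans ?_
  simp

theorem norm_sub_le_of_fderiv_le {V : 𝔼 → 𝔼} (hV : ContDiff ℝ ∞ V) {L : ℝ}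
    (hL : ∀ x, ‖fderiv ℝ V x‖ ≤ L) (x y : 𝔼) : ‖V x - V y‖ ≤ L * ‖x - y‖ :=
  convex_univ.norm_image_sub_le_of_norm_fderiv_le
    (fun x _ => hV.differentiable (by simp) x) (fun x _ => hL x) trivial trivial

/-- In the limit of large scales the variation kernel of the truncated dilations is `N + α`. -/
theorem tendsto_integral_variationKernel {α : ℝ} (hα : 0 < α) (hαN : α < N)
    {F : 𝔼 × 𝔼 → ℝ} (hF : Integrable F (volume.prod volume)) :
    Tendsto (fun n => ∫ z, F z * variationKernel α (dilationField n) z ∂(volume.prod volume)) atTop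
      (𝓝 ((N + α) * ∫ z, F z ∂(volume.prod volume))) := by
  have hN : 0 < N := by exact_mod_cast hα.trans hαN
  obtain ⟨L, hL⟩ := exists_fderiv_dilationField_le N
  have hL0 : 0 ≤ L := (norm_nonneg _).trans (hL 0 0)
  rw [← integral_const_mul]
  refine tendsto_integral_of_dominated_convergence
    (fun z => ‖F z‖ * (2 * (N * L) + (N - α) * L)) (fun n => ?_) (hF.norm.mul_const _)
    (fun n => ae_of_all _ fun z => ?_) ?_
  · have hdiv := continuous_divergence (contDiff_dilationField (N := N) n)
    have hVc := (contDiff_dilationField (N := N) n).continuous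
    have : Measurable (variationKernel α (dilationField (N := N) n)) := by
      have m1 : Measurable fun z : 𝔼 × 𝔼 => divergence (dilationField n) z.1 :=
        (hdiv.comp continuous_fst).measurable
      have m2 : Measurable fun z : 𝔼 × 𝔼 => divergence (dilationField n) z.2 :=
        (hdiv.comp continuous_snd).measurable
      have m3 : Measurable fun z : 𝔼 × 𝔼 =>
          inner ℝ (z.1 - z.2) (dilationField n z.1 - dilationField n z.2) :=
        ((continuous_fst.sub continuous_snd).inner
          ((hVc.comp continuous_fst).sub (hVc.comp continuous_snd))).measurable
      have m4 : Measurable fun z : 𝔼 × 𝔼 => ‖z.1 - z.2‖ ^ 2 :=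
        ((continuous_fst.sub continuous_snd).norm.pow 2).measurable
      exact (m1.add m2).add ((m3.div m4).const_mul _)
    exact hF.aestronglyMeasurable.mul this.aestronglyMeasurable
  · rw [norm_mul]
    gcongr
    exact abs_variationKernel_le hαN hL0
      (norm_sub_le_of_fderiv_le (contDiff_dilationField n) (hL n))
      (fun x => abs_divergence_le (hL n x)) z
  · filter_upwards [ae_prod_ne hN] with z hz
    refine tendsto_const_nhds.congr' ?_
    filter_upwards [eventually_norm_lt z.1, eventually_norm_lt z.2] with n h1 h2
    have hz' : ‖z.1 - z.2‖ ≠ 0 := norm_ne_zero_iff.2 hz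
    rw [variationKernel, divergence_dilationField_eq h1, divergence_dilationField_eq h2,
      dilationField_eq h1, dilationField_eq h2, real_inner_self_eq_norm_sq,
      div_self (pow_ne_zero 2 hz')]
    ring

/-! ### Consequences of the convergence of the convolutions -/

theorem rieszConv_eq (α r : ℝ) (u : 𝔼 → ℝ) :
    rieszConv α r u = rieszInt α (fun y => |u y| ^ r) := by
  ext x
  rw [rieszConv, convolution_eq_swap]
  rfl

theorem RieszConvExists.integrable {α r : ℝ} {u : 𝔼 → ℝ} (h : RieszConvExists α r u) :
    ∀ᵐ x, Integrable (fun y => rieszPotential N α (x - y) * |u y| ^ r) := by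
  filter_upwards [h] with x hx
  exact hx.integrable_swap

theorem aestronglyMeasurable_abs_rpow {u : 𝔼 → ℝ} (hu : AEStronglyMeasurable u) (r : ℝ) :
    AEStronglyMeasurable (fun x => |u x| ^ r) :=
  (hu.aemeasurable.abs.pow_const r).aestronglyMeasurable

theorem aestronglyMeasurable_rieszInt (α : ℝ) {a : 𝔼 → ℝ} (ha : AEStronglyMeasurable a) :
    AEStronglyMeasurable (rieszInt α a) :=
  AEStronglyMeasurable.integral_prod_right'
    (f := fun z : 𝔼 × 𝔼 => rieszPotential N α (z.1 - z.2) * a z.2)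
    ((aestronglyMeasurable_rieszPotential_sub α).mul ha.comp_snd)

theorem le_rieszPotential {α : ℝ} (hα : 0 < α) (hαN : α < N) {z : 𝔼} (hz : z ≠ 0) {D : ℝ}
    (hD : ‖z‖ ≤ D) : rieszConst N α * D ^ (α - (N : ℝ)) ≤ rieszPotential N α z := by
  rw [rieszPotential_eq]
  exact mul_le_mul_of_nonneg_left (Real.rpow_le_rpow_of_nonpos (norm_pos_iff.2 hz) hD
    (by linarith)) (rieszConst_pos hα hαN).le

theorem ae_sub_ne_zero (hN : 0 < N) (x : 𝔼) : ∀ᵐ y : 𝔼, x - y ≠ 0 := by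
  have : Nonempty (Fin N) := ⟨⟨0, hN⟩⟩
  filter_upwards [compl_mem_ae_iff.2 (measure_singleton x)] with y hy h
  exact hy (sub_eq_zero.1 h).symm

/-- If `I_α * a` converges at one point, then `a` is locally integrable. -/
theorem locallyIntegrable_of_integrable_rieszPotential {α : ℝ} (hα : 0 < α) (hαN : α < N)
    {a : 𝔼 → ℝ} (ham : AEStronglyMeasurable a) {x : 𝔼}
    (h : Integrable (fun y => rieszPotential N α (x - y) * a y)) : LocallyIntegrable a := by
  have hN : 0 < N := by exact_mod_cast hα.trans hαN
  refine locallyIntegrable_iff.2 fun K hK => ?_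
  obtain ⟨R, hR⟩ := hK.isBounded.subset_closedBall (0 : 𝔼)
  set D : ℝ := ‖x‖ + |R| + 1 with hDdef
  have hD0 : 0 < D := by positivity
  set m : ℝ := rieszConst N α * D ^ (α - (N : ℝ)) with hm
  have hm0 : 0 < m := mul_pos (rieszConst_pos hα hαN) (Real.rpow_pos_of_pos hD0 _)
  refine Integrable.mono' ((h.norm.const_mul m⁻¹).integrableOn (s := K)) ham.restrict ?_
  refine (ae_restrict_iff' hK.measurableSet).2 ?_
  filter_upwards [ae_sub_ne_zero hN x] with y hy hyK
  have hyR : ‖y‖ ≤ R := by simpa using hR hyK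
  have hle := le_rieszPotential hα hαN hy (D := D) (by
    refine (norm_sub_le x y).trans ?_
    linarith [le_abs_self R])
  rw [norm_mul, Real.norm_eq_abs (rieszPotential N α _),
    abs_of_nonneg (rieszPotential_nonneg hα hαN _), ← div_eq_inv_mul, le_div_iff₀ hm0, mul_comm]
  gcongr

/-- The Riesz potential of a nonnegative function that does not vanish identically is bounded below
by a positive constant on every ball. -/
theorem exists_le_rieszInt {α : ℝ} (hα : 0 < α) (hαN : α < N) {a : 𝔼 → ℝ} (ha0 : ∀ y, 0 ≤ a y)
    (hal : LocallyIntegrable a)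
    (ha : ∀ᵐ x, Integrable (fun y => rieszPotential N α (x - y) * a y))
    (hne : ¬ a =ᵐ[volume] 0) (R : ℝ) :
    ∃ m, 0 < m ∧ ∀ᵐ x, ‖x‖ ≤ R → m ≤ rieszInt α a x := by
  have hN : 0 < N := by exact_mod_cast hα.trans hαN
  have hai : ∀ M : ℕ, IntegrableOn a (closedBall (0 : 𝔼) M) := fun M =>
    hal.integrableOn_isCompact (isCompact_closedBall _ _)
  obtain ⟨M, hM⟩ : ∃ M : ℕ, 0 < ∫ y in closedBall (0 : 𝔼) M, a y := by
    by_contra! hcon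
    refine hne ?_
    have hz : ∀ᵐ y, ∀ M : ℕ, y ∈ closedBall (0 : 𝔼) M → a y = 0 := ae_all_iff.2 fun M => by
      refine (ae_restrict_iff' measurableSet_closedBall).1 ?_
      exact (setIntegral_eq_zero_iff_of_nonneg_ae (ae_of_all _ ha0) (hai M)).1
        (le_antisymm (hcon M) (integral_nonneg ha0))
    filter_upwards [hz] with y hy
    obtain ⟨M, hM⟩ := exists_nat_ge ‖y‖
    exact hy M (by simpa using hM)
  set D : ℝ := |R| + M + 1 with hDdef
  have hD0 : 0 < D := by positivity
  set m : ℝ := rieszConst N α * D ^ (α - (N : ℝ)) with hm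
  have hm0 : 0 < m := mul_pos (rieszConst_pos hα hαN) (Real.rpow_pos_of_pos hD0 _)
  refine ⟨m * ∫ y in closedBall (0 : 𝔼) M, a y, mul_pos hm0 hM, ?_⟩
  filter_upwards [ha] with x hx hxR
  calc m * ∫ y in closedBall (0 : 𝔼) M, a y = ∫ y in closedBall (0 : 𝔼) M, m * a y := by
        rw [integral_const_mul]
    _ ≤ ∫ y in closedBall (0 : 𝔼) M, rieszPotential N α (x - y) * a y := by
        refine setIntegral_mono_on_ae ((hai M).const_mul m) hx.integrableOn
          measurableSet_closedBall ?_
        filter_upwards [ae_sub_ne_zero hN x] with y hy hyM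
        have hyM' : ‖y‖ ≤ M := by simpa using hyM
        refine mul_le_mul_of_nonneg_right (le_rieszPotential hα hαN hy ?_) (ha0 y)
        refine (norm_sub_le x y).trans ?_
        linarith [le_abs_self R]
    _ ≤ ∫ y, rieszPotential N α (x - y) * a y :=
        setIntegral_le_integral hx (ae_of_all _ fun y =>
          mul_nonneg (rieszPotential_nonneg hα hαN _) (ha0 y))

/-! ### Limits of the linear terms -/

/-- A nonnegative source `u - Δu` times `u` is integrable when `u` has finite `H¹` norm: test with
`χ u` and let the cutoff grow. -/
theorem integrable_sub_laplacian_mul_self {u : 𝔼 → ℝ} {g : Fin N → 𝔼 → ℝ}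
    {h : Fin N → Fin N → 𝔼 → ℝ} (hu : ∀ i, HasWeakDeriv (stdVec i) u (g i))
    (hg : ∀ j i, HasWeakDeriv (stdVec i) (g j) (h j i)) (hu2 : MemLp u 2)
    (hg2 : ∀ i, MemLp (g i) 2) (hh2 : ∀ j i, MemL2Loc (h j i))
    (h0 : ∀ᵐ x, 0 ≤ (u x - ∑ i, h i i x) * u x) :
    Integrable (fun x => (u x - ∑ i, h i i x) * u x) := by
  have hu2' : MemL2Loc u := fun K _ => hu2.restrict K
  have hg2' : ∀ i, MemL2Loc (g i) := fun i K _ => (hg2 i).restrict K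
  have hli : LocallyIntegrable (fun x => (u x - ∑ i, h i i x) * u x) := by
    refine locallyIntegrable_iff.2 fun K hK => ?_
    exact ((hu2' K hK).sub (memLp_finsetSum _ fun i _ => hh2 i i K hK)).integrable_mul (hu2' K hK)
  have iuu : Integrable (fun x => u x * u x) := hu2.integrable_mul hu2
  have igg : Integrable (fun x => ∑ i, g i x * g i x) :=
    integrable_finsetSum _ fun i _ => (hg2 i).integrable_mul (hg2 i)
  have iug : ∀ i, Integrable (fun x => |u x * g i x|) := fun i => (hu2.integrable_mul (hg2 i)).abs
  obtain ⟨C, hC⟩ := exists_fderiv_cutoff_le N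
  have hd : ∀ n (x : 𝔼) (i : Fin N), |fderiv ℝ (cutoff N n) x (stdVec i)| ≤ C := fun n x i => by
    refine ((fderiv ℝ (cutoff N n) x).le_opNorm _).trans ?_
    simpa using hC n x
  have hball : AECover (volume : Measure 𝔼) atTop fun n : ℕ => closedBall (0 : 𝔼) n :=
    aecover_closedBall tendsto_natCast_atTop_atTop
  refine hball.integrable_of_integral_bounded_of_nonneg_ae
    ((∫ x, u x * u x) + (∫ x, ∑ i, g i x * g i x) + ∫ x, ∑ i, |u x * g i x| * C)
    (fun n => hli.integrableOn_isCompact (isCompact_closedBall _ _)) h0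
    (Eventually.of_forall fun n => ?_)
  have hχ := contDiff_cutoff (N := N) n
  have hχc := hasCompactSupport_cutoff (N := N) n
  have hint : Integrable (fun x => cutoff N n x * ((u x - ∑ i, h i i x) * u x)) :=
    hli.integrable_smul_left_of_hasCompactSupport hχ.continuous hχc
  calc ∫ x in closedBall (0 : 𝔼) n, (u x - ∑ i, h i i x) * u x
      = ∫ x in closedBall (0 : 𝔼) n, cutoff N n x * ((u x - ∑ i, h i i x) * u x) := by
        refine setIntegral_congr_fun measurableSet_closedBall fun x hx => ?_
        have hx' : ‖x‖ ≤ n := by simpa using hx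
        simp only [cutoff_eq_one (N := N) (n := n) (x := x) (by linarith), one_mul]
    _ ≤ ∫ x, cutoff N n x * ((u x - ∑ i, h i i x) * u x) := by
        refine setIntegral_le_integral hint ?_
        filter_upwards [h0] with x hx
        exact mul_nonneg (cutoff_nonneg n x) hx
    _ = _ := integral_sub_laplacian_mul_self hu hg hu2' hg2' hh2 hχ hχc
    _ ≤ _ := by
        refine add_le_add (add_le_add ?_ ?_) ?_
        · refine integral_mono_of_nonneg (ae_of_all _ fun x => mul_nonneg (cutoff_nonneg n x)
            (mul_self_nonneg _)) iuu (ae_of_all _ fun x => ?_)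
          exact mul_le_of_le_one_left (mul_self_nonneg _) (cutoff_le_one n x)
        · have hs : ∀ x, 0 ≤ ∑ i, g i x * g i x := fun x =>
            Finset.sum_nonneg fun i _ => mul_self_nonneg _
          refine integral_mono_of_nonneg (ae_of_all _ fun x => mul_nonneg (cutoff_nonneg n x)
            (hs x)) igg (ae_of_all _ fun x => ?_)
          exact mul_le_of_le_one_left (hs x) (cutoff_le_one n x)
        · refine integral_mono (integrable_finsetSum _ fun i _ => ?_)
            (integrable_finsetSum _ fun i _ => (iug i).mul_const C) fun x =>
              Finset.sum_le_sum fun i _ => ?_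
          · have hl := (hu2.integrable_mul (hg2 i)).locallyIntegrable
            exact hl.integrable_smul_right_of_hasCompactSupport
              ((hχ.continuous_fderiv (by simp)).clm_apply continuous_const) (hχc.fderiv_apply ℝ _)
          · refine (le_abs_self _).trans ?_
            rw [abs_mul]
            exact mul_le_mul_of_nonneg_left (hd n x i) (abs_nonneg _)

theorem tendsto_integral_mul_divergence {w : 𝔼 → ℝ} (hw : Integrable w) :
    Tendsto (fun n => ∫ x, w x * divergence (dilationField (N := N) n) x) atTop
      (𝓝 (N * ∫ x, w x)) := by
  obtain ⟨L, hL⟩ := exists_fderiv_dilationField_le N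
  rw [← integral_const_mul]
  refine tendsto_integral_of_dominated_convergence (fun x => ‖w x‖ * (N * L)) (fun n => ?_)
    (hw.norm.mul_const _) (fun n => ae_of_all _ fun x => ?_) (ae_of_all _ fun x => ?_)
  · exact hw.aestronglyMeasurable.mul
      (continuous_divergence (contDiff_dilationField n)).aestronglyMeasurable
  · rw [norm_mul]
    gcongr
    exact abs_divergence_le (hL n x)
  · refine tendsto_const_nhds.congr' ?_
    filter_upwards [eventually_norm_lt x] with n hn
    rw [divergence_dilationField_eq hn, mul_comm]

theorem tendsto_integral_mul_fderiv_dilationField {g : Fin N → 𝔼 → ℝ}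
    (hg : ∀ i j, Integrable (fun x => g i x * g j x)) :
    Tendsto (fun n => ∫ x, ∑ i, ∑ j, g i x * g j x *
      fderiv ℝ (dilationField (N := N) n) x (stdVec i) j) atTop
      (𝓝 (∫ x, ∑ i, g i x * g i x)) := by
  obtain ⟨L, hL⟩ := exists_fderiv_dilationField_le N
  refine tendsto_integral_of_dominated_convergence
    (fun x => ∑ i, ∑ j, ‖g i x * g j x‖ * L) (fun n => ?_)
    (integrable_finsetSum _ fun i _ => integrable_finsetSum _ fun j _ =>
      (hg i j).norm.mul_const _) (fun n => ae_of_all _ fun x => ?_) (ae_of_all _ fun x => ?_)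
  · exact Finset.aestronglyMeasurable_fun_sum _ fun i _ =>
      Finset.aestronglyMeasurable_fun_sum _ fun j _ => (hg i j).aestronglyMeasurable.mul
        (continuous_fderiv_coord (contDiff_dilationField n) _ j).aestronglyMeasurable
  · refine (norm_sum_le _ _).trans (Finset.sum_le_sum fun i _ => (norm_sum_le _ _).trans
      (Finset.sum_le_sum fun j _ => ?_))
    rw [norm_mul]
    gcongr
    exact abs_fderiv_coord_le (hL n x) i j
  · refine tendsto_const_nhds.congr' ?_
    filter_upwards [eventually_norm_lt x] with n hn
    simp [fderiv_dilationField_eq hn]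

/-! ### The equation -/

theorem abs_rpow_sub_two_mul_mul_self {q : ℝ} (hq : 0 < q) (t : ℝ) :
    |t| ^ (q - 2) * t * t = |t| ^ q := by
  rcases eq_or_ne t 0 with rfl | ht
  · simp [Real.zero_rpow hq.ne']
  · rw [mul_assoc, ← abs_mul_abs_self t, ← pow_two, ← Real.rpow_natCast,
      ← Real.rpow_add (abs_pos.2 ht)]
    congr 1; push_cast; ring

/-- A weak solution with second weak derivatives satisfies the equation almost everywhere. -/
theorem IsWeakSolution.ae_eq {α p q : ℝ} {u : 𝔼 → ℝ} {G : 𝔼 → 𝔼} (hu : IsWeakSolution α p q u)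
    (hG : IsWeakGradient u G) {h : Fin N → 𝔼 → ℝ}
    (hh : ∀ i, HasWeakDeriv (stdVec i) (fun x => G x i) (h i)) :
    choquardRHS α p q u =ᵐ[volume] fun x => u x - ∑ i, h i x := by
  have hsum : LocallyIntegrable (fun x => ∑ i, h i x) := locallyIntegrable_iff.2 fun K hK =>
    integrable_finsetSum _ fun i _ => (hh i).2.1.integrableOn_isCompact hK
  refine ae_eq_of_integral_contDiff_smul_eq hu.locallyIntegrable_rhs (hG.1.sub hsum)
    fun φ hφ hφc => ?_
  have e := hu.weak_eq G hG φ hφ hφc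
  have e1 : ∫ x, inner ℝ (G x) (∇ φ x) = - ∫ x, φ x * ∑ i, h i x := by
    have : ∀ x, inner ℝ (G x) (∇ φ x) = ∑ i, G x i * fderiv ℝ φ x (stdVec i) := fun x => by
      rw [PiLp.inner_apply]
      refine Finset.sum_congr rfl fun i _ => ?_
      rw [← gradient_apply]
      simp [mul_comm]
    simp only [this, Finset.mul_sum]
    rw [integral_finsetSum, integral_finsetSum, ← Finset.sum_neg_distrib]
    · exact Finset.sum_congr rfl fun i _ => (hh i).2.2 φ hφ hφc
    · exact fun i _ => (hh i).2.1.integrable_smul_left_of_hasCompactSupport hφ.continuous hφc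
    · exact fun i _ => (hh i).1.integrable_smul_right_of_hasCompactSupport
        ((hφ.continuous_fderiv (by simp)).clm_apply continuous_const) (hφc.fderiv_apply ℝ _)
  have i1 : Integrable (fun x => φ x * u x) :=
    hG.1.integrable_smul_left_of_hasCompactSupport hφ.continuous hφc
  have i2 : Integrable (fun x => φ x * ∑ i, h i x) :=
    hsum.integrable_smul_left_of_hasCompactSupport hφ.continuous hφc
  simp only [smul_eq_mul, mul_sub]
  rw [integral_sub i1 i2]
  simp only [mul_comm (φ _) (u _), mul_comm (φ _) (choquardRHS _ _ _ _ _)]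
  rw [← e, e1]
  ring

/-! ### Local integrability of the gradients of the powers -/

/-- Since `I_α * |u|^r` is bounded below on balls, local integrability of
`(I_α * |u|^r) |u|^(t-1) |g|` gives that of `|u|^(t-1) |g|`. -/
theorem locallyIntegrable_rpow_mul {α r t : ℝ} (hα : 0 < α) (hαN : α < N) (hr : 0 < r)
    {u g F : 𝔼 → ℝ} (hu : AEStronglyMeasurable u) (hg : AEStronglyMeasurable g)
    (hconv : RieszConvExists α r u) (hl : LocallyIntegrable (fun x => |u x| ^ r))
    (hF : LocallyIntegrable F)
    (hle : ∀ᵐ x, rieszInt α (fun y => |u y| ^ r) x * |(|u x| ^ (t - 2) * u x * g x)| ≤ |F x|) :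
    LocallyIntegrable (fun x => |u x| ^ (t - 2) * u x * g x) := by
  have hm : AEStronglyMeasurable (fun x => |u x| ^ (t - 2) * u x * g x) :=
    ((aestronglyMeasurable_abs_rpow hu _).mul hu).mul hg
  by_cases hne : (fun x => |u x| ^ r) =ᵐ[volume] 0
  · refine (locallyIntegrable_zero (ε'' := ℝ)).mono hm ?_
    filter_upwards [hne] with x hx
    have : u x = 0 := by
      simpa using (Real.rpow_eq_zero (abs_nonneg _) hr.ne').1 hx
    simp [this]
  · refine locallyIntegrable_iff.2 fun K hK => ?_
    obtain ⟨R, hR⟩ := hK.isBounded.subset_closedBall (0 : 𝔼)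
    obtain ⟨m, hm0, hmle⟩ := exists_le_rieszInt hα hαN (fun y => by positivity) hl
      hconv.integrable hne R
    refine Integrable.mono' ((hF.integrableOn_isCompact hK).norm.const_mul m⁻¹) hm.restrict ?_
    refine (ae_restrict_iff' hK.measurableSet).2 ?_
    filter_upwards [hmle, hle] with x hx1 hx2 hxK
    have hxR : ‖x‖ ≤ R := by simpa using hR hxK
    rw [← div_eq_inv_mul, le_div_iff₀ hm0, mul_comm, Real.norm_eq_abs, Real.norm_eq_abs]
    exact (mul_le_mul_of_nonneg_right (hx1 hxR) (abs_nonneg _)).trans hx2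

end EuclideanSpace

end Choquard

open MeasureTheory Choquard in
theorem lemma4p1 (N : ℕ) (hN : 3 ≤ N) (α p q : ℝ) (hα : 0 < α) (hαN : α < N)
    (hp : 0 < p) (hq : 0 < q)
    (u : EuclideanSpace ℝ (Fin N) → ℝ)
    (G : EuclideanSpace ℝ (Fin N) → EuclideanSpace ℝ (Fin N))
    (hu : IsWeakSolution α p q u)
    (huL : MemLp u (ENNReal.ofReal (N * (p + q) / (N + α))))
    (hG : IsWeakGradient u G)
    (hGloc : ∀ i : Fin N, MemH1Loc (fun x => G x i)) :
    Integrable (fun x => ‖G x‖ ^ 2) ∧ Integrable (fun x => |u x| ^ 2) ∧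
    Integrable (fun x => rieszConv α p u x * |u x| ^ q) ∧
    ((N : ℝ) - 2) / 2 * (∫ x, ‖G x‖ ^ 2) + (N : ℝ) / 2 * (∫ x, |u x| ^ 2) =
      ((N : ℝ) + α) * ∫ x, rieszConv α p u x * |u x| ^ q := by
  obtain ⟨hu2, G', hG', hG'2⟩ := hu.memH1
  have hG2 : MemLp G 2 := hG'2.ae_eq (hG'.ae_eq hG)
  choose hGl2 H hH hH2 using hGloc
  set g : Fin N → EuclideanSpace ℝ (Fin N) → ℝ := fun i x => G x i with hgdef
  set h : Fin N → Fin N → EuclideanSpace ℝ (Fin N) → ℝ := fun j i x => H j x i with hhdef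
  have hug : ∀ i, HasWeakDeriv (stdVec i) u (g i) := fun i => hG.hasWeakDeriv i
  have hgh : ∀ j i, HasWeakDeriv (stdVec i) (g j) (h j i) := fun j i => (hH j).hasWeakDeriv i
  have hg2 : ∀ i, MemLp (g i) 2 := fun i =>
    (EuclideanSpace.proj (𝕜 := ℝ) i).comp_memLp' hG2
  have hh2 : ∀ j i, MemL2Loc (h j i) := fun j i K hK =>
    (EuclideanSpace.proj (𝕜 := ℝ) i).comp_memLp' (hH2 j K hK)
  have hu2' : MemL2Loc u := fun K _ => hu2.restrict K
  have hg2' : ∀ i, MemL2Loc (g i) := fun i K _ => (hg2 i).restrict K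
  have hum : AEStronglyMeasurable u := hu2.aestronglyMeasurable
  have iuu : Integrable (fun x => u x * u x) := hu2.integrable_mul hu2
  have igg : ∀ i j, Integrable (fun x => g i x * g j x) := fun i j => (hg2 i).integrable_mul (hg2 j)
  have igs : Integrable (fun x => ∑ i, g i x * g i x) := integrable_finsetSum _ fun i _ => igg i i
  have eG : ∀ x, ‖G x‖ ^ 2 = ∑ i, g i x * g i x := fun x => by
    rw [EuclideanSpace.norm_sq_eq]
    simp [hgdef, pow_two]
  have eu : ∀ x, |u x| ^ 2 = u x * u x := fun x => by rw [sq_abs, pow_two]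
  -- the equation, almost everywhere
  set a : EuclideanSpace ℝ (Fin N) → ℝ := fun x => |u x| ^ p with hadef
  set b : EuclideanSpace ℝ (Fin N) → ℝ := fun x => |u x| ^ q with hbdef
  set f : EuclideanSpace ℝ (Fin N) → ℝ := fun x => u x - ∑ i, h i i x with hfdef
  have hf : ∀ᵐ x, q * rieszInt α a x * (|u x| ^ (q - 2) * u x)
      + p * rieszInt α b x * (|u x| ^ (p - 2) * u x) = f x := by
    filter_upwards [hu.ae_eq hG fun i => hgh i i] with x hx
    rw [choquardRHS, rieszConv_eq, rieszConv_eq] at hx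
    exact hx
  have hf2 : MemL2Loc f := fun K hK =>
    (hu2' K hK).sub (memLp_finsetSum _ fun i _ => hh2 i i K hK)
  have ha0 : ∀ x, 0 ≤ a x := fun x => by positivity
  have hb0 : ∀ x, 0 ≤ b x := fun x => by positivity
  have hIa0 := rieszInt_nonneg hα hαN ha0
  have hIb0 := rieszInt_nonneg hα hαN hb0
  have ham : AEStronglyMeasurable a := aestronglyMeasurable_abs_rpow hum p
  have hbm : AEStronglyMeasurable b := aestronglyMeasurable_abs_rpow hum q
  have hIam := aestronglyMeasurable_rieszInt α ham
  have hIbm := aestronglyMeasurable_rieszInt α hbm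
  have hca := hu.conv_p.integrable
  have hcb := hu.conv_q.integrable
  have hal : LocallyIntegrable a := by
    obtain ⟨x, hx⟩ := hca.exists
    exact locallyIntegrable_of_integrable_rieszPotential hα hαN ham hx
  have hbl : LocallyIntegrable b := by
    obtain ⟨x, hx⟩ := hcb.exists
    exact locallyIntegrable_of_integrable_rieszPotential hα hαN hbm hx
  -- integrability of the source times `u`, and hence of the nonlinear energy
  have hfu : ∀ᵐ x, f x * u x = q * (rieszInt α a x * b x) + p * (rieszInt α b x * a x) := by
    filter_upwards [hf] with x hx
    rw [← hx, hadef, hbdef]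
    simp only
    rw [← abs_rpow_sub_two_mul_mul_self hq, ← abs_rpow_sub_two_mul_mul_self hp]
    ring
  have hfui : Integrable (fun x => f x * u x) := by
    refine integrable_sub_laplacian_mul_self hug hgh hu2 hg2 hh2 ?_
    filter_upwards [hfu] with x hx
    change 0 ≤ f x * u x
    rw [hx]
    have := hIa0 x; have := hIb0 x; have := ha0 x; have := hb0 x
    positivity
  have iab : Integrable (fun x => rieszInt α a x * b x) := by
    refine (hfui.const_mul q⁻¹).mono' (hIam.mul hbm) ?_
    filter_upwards [hfu] with x hx
    have h1 := mul_nonneg (hIa0 x) (hb0 x)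
    have h2 := mul_nonneg hp.le (mul_nonneg (hIb0 x) (ha0 x))
    rw [hx, Real.norm_eq_abs, abs_of_nonneg h1, ← div_eq_inv_mul, le_div_iff₀ hq]
    linarith
  have iΦ := integrable_rieszPotential_mul hα hαN ha0 ham hca hbm iab
  -- both summands of the source have the sign of `u`, so each is dominated by the whole
  have hboth : ∀ᵐ x, rieszInt α a x * |q * (|u x| ^ (q - 2) * u x)| ≤ |f x| ∧
      rieszInt α b x * |p * (|u x| ^ (p - 2) * u x)| ≤ |f x| := by
    filter_upwards [hf] with x hx
    have e : f x = (q * rieszInt α a x * |u x| ^ (q - 2) + p * rieszInt α b x * |u x| ^ (p - 2))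
        * u x := by rw [← hx]; ring
    have h1 : 0 ≤ q * rieszInt α a x * |u x| ^ (q - 2) :=
      mul_nonneg (mul_nonneg hq.le (hIa0 x)) (by positivity)
    have h2 : 0 ≤ p * rieszInt α b x * |u x| ^ (p - 2) :=
      mul_nonneg (mul_nonneg hp.le (hIb0 x)) (by positivity)
    rw [e, abs_mul (_ + _), abs_of_nonneg (add_nonneg h1 h2)]
    simp only [abs_mul, abs_of_pos hq, abs_of_pos hp, abs_of_nonneg (Real.rpow_nonneg
      (abs_nonneg (u x)) _)]
    have h3 := mul_nonneg h1 (abs_nonneg (u x))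
    have h4 := mul_nonneg h2 (abs_nonneg (u x))
    constructor <;> linarith
  have hfg : ∀ i, LocallyIntegrable (fun x => f x * g i x) := fun i =>
    hf2.locallyIntegrable_mul (hg2' i)
  have hgm : ∀ i, AEStronglyMeasurable (g i) := fun i => (hg2 i).aestronglyMeasurable
  have lb : ∀ i, LocallyIntegrable (fun x => |u x| ^ (q - 2) * u x * g i x) := fun i => by
    refine locallyIntegrable_rpow_mul hα hαN hp hum (hgm i) hu.conv_p hal ((hfg i).smul q⁻¹) ?_
    filter_upwards [hboth] with x hx
    have h1 := mul_le_mul_of_nonneg_right hx.1 (abs_nonneg (g i x))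
    rw [abs_mul q, abs_of_pos hq] at h1
    simp only [Pi.smul_apply, smul_eq_mul]
    rw [abs_mul q⁻¹, abs_of_pos (inv_pos.2 hq), ← div_eq_inv_mul, le_div_iff₀ hq, abs_mul (f x),
      abs_mul (_ * u x)]
    linarith
  have la : ∀ i, LocallyIntegrable (fun x => |u x| ^ (p - 2) * u x * g i x) := fun i => by
    refine locallyIntegrable_rpow_mul hα hαN hq hum (hgm i) hu.conv_q hbl ((hfg i).smul p⁻¹) ?_
    filter_upwards [hboth] with x hx
    have h1 := mul_le_mul_of_nonneg_right hx.2 (abs_nonneg (g i x))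
    rw [abs_mul p, abs_of_pos hp] at h1
    simp only [Pi.smul_apply, smul_eq_mul]
    rw [abs_mul p⁻¹, abs_of_pos (inv_pos.2 hp), ← div_eq_inv_mul, le_div_iff₀ hp, abs_mul (f x),
      abs_mul (_ * u x)]
    linarith
  set wb : Fin N → EuclideanSpace ℝ (Fin N) → ℝ :=
    fun i x => q * (|u x| ^ (q - 2) * u x) * g i x with hwbdef
  set wa : Fin N → EuclideanSpace ℝ (Fin N) → ℝ :=
    fun i x => p * (|u x| ^ (p - 2) * u x) * g i x with hwadef
  have hb : ∀ i, HasWeakDeriv (stdVec i) b (wb i) := fun i => (hug i).abs_rpow hq hbl (lb i)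
  have ha : ∀ i, HasWeakDeriv (stdVec i) a (wa i) := fun i => (hug i).abs_rpow hp hal (la i)
  -- testing the equation against the truncated dilations
  obtain ⟨L, hL⟩ := exists_fderiv_dilationField_le N
  have hn : ∀ n, - (∫ z : EuclideanSpace ℝ (Fin N) × EuclideanSpace ℝ (Fin N),
        rieszPotential N α (z.1 - z.2) * a z.2 * b z.1 * variationKernel α (dilationField n) z
          ∂(volume.prod volume))
      = - (1 / 2) * (∫ x, u x * u x * divergence (dilationField n) x)
        - (1 / 2) * (∫ x, (∑ j, g j x * g j x) * divergence (dilationField n) x)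
        + ∫ x, ∑ i, ∑ j, g i x * g j x * fderiv ℝ (dilationField n) x (stdVec i) j := fun n => by
    have hV := contDiff_dilationField (N := N) n
    have hVc := hasCompactSupport_dilationField (N := N) n
    have ifg : ∀ i, Integrable (fun x => dilationField n x i * (f x * g i x)) := fun i =>
      (hfg i).integrable_smul_left_of_hasCompactSupport (contDiff_coord hV i).continuous
        (hasCompactSupport_coord hVc i)
    have hVm : ∀ i, AEStronglyMeasurable (fun x : EuclideanSpace ℝ (Fin N) =>
      dilationField n x i) := fun i => (contDiff_coord hV i).continuous.aestronglyMeasurable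
    have ib : Integrable (fun x => rieszInt α a x * ∑ i, dilationField n x i * wb i x) := by
      simp only [Finset.mul_sum]
      refine integrable_finsetSum _ fun i _ => (ifg i).mono
        (hIam.mul ((hVm i).mul (hb i).2.1.aestronglyMeasurable)) ?_
      filter_upwards [hboth] with x hx
      have h1 := mul_le_mul_of_nonneg_left hx.1
        (mul_nonneg (abs_nonneg (dilationField n x i)) (abs_nonneg (g i x)))
      simp only [hwbdef, Real.norm_eq_abs]
      rw [abs_mul (rieszInt α a x), abs_of_nonneg (hIa0 x), abs_mul (dilationField n x i),
        abs_mul (q * _), abs_mul (dilationField n x i), abs_mul (f x)]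
      linarith
    have ia : Integrable (fun x => rieszInt α b x * ∑ i, dilationField n x i * wa i x) := by
      simp only [Finset.mul_sum]
      refine integrable_finsetSum _ fun i _ => (ifg i).mono
        (hIbm.mul ((hVm i).mul (ha i).2.1.aestronglyMeasurable)) ?_
      filter_upwards [hboth] with x hx
      have h1 := mul_le_mul_of_nonneg_left hx.2
        (mul_nonneg (abs_nonneg (dilationField n x i)) (abs_nonneg (g i x)))
      simp only [hwadef, Real.norm_eq_abs]
      rw [abs_mul (rieszInt α b x), abs_of_nonneg (hIb0 x), abs_mul (dilationField n x i),
        abs_mul (p * _), abs_mul (dilationField n x i), abs_mul (f x)]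
      linarith
    have hsm : ∀ {w : Fin N → EuclideanSpace ℝ (Fin N) → ℝ},
        (∀ i, AEStronglyMeasurable (w i)) →
        AEStronglyMeasurable (fun x => ∑ i, dilationField n x i * w i x) := fun hw =>
      Finset.aestronglyMeasurable_fun_sum _ fun i _ => (hVm i).mul (hw i)
    have key := integral_rieszInt_mul_field hα hαN hal hbl ha hb iΦ hV hVc
      (norm_sub_le_of_fderiv_le hV (hL n)) (fun x => abs_divergence_le (hL n x))
      (integrable_rieszPotential_mul hα hαN ha0 ham hca
        (hsm fun i => (hb i).2.1.aestronglyMeasurable) ib)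
      (integrable_rieszPotential_mul hα hαN hb0 hbm hcb
        (hsm fun i => (ha i).2.1.aestronglyMeasurable) ia)
    rw [← key, ← integral_add ib ia,
      ← integral_sub_laplacian_mul_field hug hgh hu2' hg2' hh2 hV hVc]
    refine integral_congr_ae ?_
    filter_upwards [hf] with x hx
    change _ = f x * _
    rw [← hx]
    simp only [Finset.mul_sum, ← Finset.sum_add_distrib, hwadef, hwbdef]
    exact Finset.sum_congr rfl fun i _ => by ring
  have lim1 := (tendsto_integral_variationKernel hα hαN iΦ).neg
  have lim2 := (((tendsto_integral_mul_divergence iuu).const_mul (-(1 / 2) : ℝ)).sub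
    ((tendsto_integral_mul_divergence igs).const_mul (1 / 2))).add
      (tendsto_integral_mul_fderiv_dilationField igg)
  have fin := tendsto_nhds_unique (lim1.congr hn) lim2
  rw [integral_rieszPotential_mul iΦ] at fin
  simp only [eG, eu, rieszConv_eq]
  refine ⟨igs, iuu, iab, ?_⟩
  linarith
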